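/- **Setting.** Let $\mathcal X_1,\mathcal X_2,\mathcal X_3,\mathcal Y_1,\mathcal Y_2,\mathcal Y_3$ be non-empty standard Borel spaces (for instance finite or Euclidean) and let $P_{Y_1Y_2Y_3|X_1X_2X_3}$ be a transition probability from $\mathcal X_1\times\mathcal X_2\times\mathcal X_3$ to $\mathcal Y_1\times\mathcal Y_2\times\mathcal Y_3$. The general memoryless $3$-user cognitive interference channel with cognitive-only message sharing (3-CIFC-CoMS) uses this channel $N$ times without memory, so that given the input block the output triples at different times are independent. A code of block length $N$ and rates $R_1,R_2,R_3\ge 0$ (in bits per channel use) consists of mutually independent messages $W_i$, uniform on the set $[1:2^{NR_i}]$ of integers from $1$ to $2^{NR_i}$; encoders $X_1^N=f_1(W_1)$, $X_2^N=f_2(W_2)$, $X_3^N=f_3(W_1,W_2,W_3)$; and (measurable) decoders $\widehat W_i=g_i(Y_i^N)$, $i=1,2,3$. The capacity region is the set of all $(R_1,R_2,R_3)$ for which there is a sequence of such codes, one for each $N$, with $\max_{i}\mathbb P[\widehat W_i\ne W_i]\to 0$ as $N\to\infty$. The sum-capacity $C_\Sigma\in[0,\infty]$ is the supremum of $R_1+R_2+R_3$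 over the capacity region. For a joint input distribution $P=P_{X_1X_2X_3}$ (not necessarily a product), let $(X_1,X_2,X_3,Y_1,Y_2,Y_3)\sim P_{X_1X_2X_3}P_{Y_1Y_2Y_3|X_1X_2X_3}$ and define, with (conditional) mutual informations in bits, $$a(P):=\min\{I(Y_3;X_3|X_1,X_2,Y_1),\,I(Y_3;X_3|X_1,X_2,Y_2)\}+I(Y_1;X_1,X_3|X_2)+I(Y_2;X_2,X_3|X_1),$$ $$b(P):=\min\{I(Y_1;X_1,X_2,X_3)+I(Y_2;X_2,X_3|X_1,Y_1),\; I(Y_1;X_1,X_3|X_2,Y_2)+I(Y_2;X_1,X_2,X_3)\}+I(Y_3;X_3|X_2,Y_2,X_1,Y_1).$$ **Corollary.** The sum-capacity of the general memoryless 3-CIFC-CoMS satisfies $$C_\Sigma\le\sup_{P_{X_1X_2X_3}}\min\big(a(P),b(P)\big).$$ If moreover the input alphabets $\mathcal X_1,\mathcal X_2,\mathcal X_3$ are finite, then there is a single input distribution $P_{X_1X_2X_3}$ with $C_\Sigma\le\min\big(a(P),b(P)\big)$. -/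

import Mathlib

open MeasureTheory ProbabilityTheory InformationTheory Filter Topology
open scoped ENNReal

noncomputable section

namespace CoMS

section Information

variable {Ω α β γ : Type*} [MeasurableSpace Ω] [MeasurableSpace α] [MeasurableSpace β]
  [MeasurableSpace γ]

/-- Mutual information `I(U; V)` in bits: the Kullback-Leibler divergence of the joint law of
`(U, V)` from the product of the marginal laws. -/
def mutualInfo (U : Ω → α) (V : Ω → β) (μ : Measure Ω) : ℝ≥0∞ :=
  klDiv (μ.map fun ω => (U ω, V ω)) ((μ.map U).prod (μ.map V)) / ENNReal.ofReal (Real.log 2)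

/-- Conditional mutual information `I(U; V | Z)` in bits: the Kullback-Leibler divergence of the
joint law `P_{Z,U,V}` from `P_Z P_{U|Z} P_{V|Z}`, under which `U` and `V` are conditionally
independent given `Z`. -/
def condMutualInfo [StandardBorelSpace α] [Nonempty α] [StandardBorelSpace β] [Nonempty β]
    (U : Ω → α) (V : Ω → β) (Z : Ω → γ) (μ : Measure Ω) [IsFiniteMeasure μ] : ℝ≥0∞ :=
  klDiv (μ.map fun ω => (Z ω, (U ω, V ω)))
      (μ.map Z ⊗ₘ (condDistrib U Z μ ×ₖ condDistrib V Z μ)) /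
    ENNReal.ofReal (Real.log 2)

end Information

section Coding

variable (X₁ X₂ X₃ Y₁ Y₂ Y₃ : Type*) [MeasurableSpace Y₁] [MeasurableSpace Y₂]
  [MeasurableSpace Y₃]

/-- A block code of length `N` for the 3-user cognitive interference channel with cognitive-only
message sharing, with `Mᵢ` messages for user `i`. The primary encoders 1 and 2 know only their own
message, the cognitive encoder 3 knows all three messages, and decoder `i` sees only the `i`-th
output sequence. -/
structure Code (N M₁ M₂ M₃ : ℕ) where
  enc₁ : Fin M₁ → Fin N → X₁
  enc₂ : Fin M₂ → Fin N → X₂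
  enc₃ : Fin M₁ × Fin M₂ × Fin M₃ → Fin N → X₃
  dec₁ : (Fin N → Y₁) → Fin M₁
  dec₂ : (Fin N → Y₂) → Fin M₂
  dec₃ : (Fin N → Y₃) → Fin M₃
  measurable_dec₁ : Measurable dec₁
  measurable_dec₂ : Measurable dec₂
  measurable_dec₃ : Measurable dec₃

end Coding

section Channel

variable {X₁ X₂ X₃ Y₁ Y₂ Y₃ : Type*} [MeasurableSpace X₁] [MeasurableSpace X₂]
  [MeasurableSpace X₃] [MeasurableSpace Y₁] [MeasurableSpace Y₂] [MeasurableSpace Y₃]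

namespace Code

variable {N M₁ M₂ M₃ : ℕ}

/-- The three inputs at time `t` when the messages are `w`. -/
def input (c : Code X₁ X₂ X₃ Y₁ Y₂ Y₃ N M₁ M₂ M₃) (w : Fin M₁ × Fin M₂ × Fin M₃) (t : Fin N) :
    X₁ × X₂ × X₃ :=
  (c.enc₁ w.1 t, c.enc₂ w.2.1 t, c.enc₃ w t)

/-- The law of the output block when the messages are `w` and the channel `W` is used without
memory: the product over time of the single-letter output laws. -/
def outputLaw (c : Code X₁ X₂ X₃ Y₁ Y₂ Y₃ N M₁ M₂ M₃) (W : Kernel (X₁ × X₂ × X₃) (Y₁ × Y₂ × Y₃))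
    (w : Fin M₁ × Fin M₂ × Fin M₃) : Measure (Fin N → Y₁ × Y₂ × Y₃) :=
  Measure.pi fun t => W (c.input w t)

/-- Error probability of user 1, for independent, uniformly distributed messages. -/
def errorProb₁ (c : Code X₁ X₂ X₃ Y₁ Y₂ Y₃ N M₁ M₂ M₃)
    (W : Kernel (X₁ × X₂ × X₃) (Y₁ × Y₂ × Y₃)) : ℝ≥0∞ :=
  (∑ w, c.outputLaw W w {y | c.dec₁ (fun t => (y t).1) ≠ w.1}) / (M₁ * M₂ * M₃)

/-- Error probability of user 2, for independent, uniformly distributed messages. -/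
def errorProb₂ (c : Code X₁ X₂ X₃ Y₁ Y₂ Y₃ N M₁ M₂ M₃)
    (W : Kernel (X₁ × X₂ × X₃) (Y₁ × Y₂ × Y₃)) : ℝ≥0∞ :=
  (∑ w, c.outputLaw W w {y | c.dec₂ (fun t => (y t).2.1) ≠ w.2.1}) / (M₁ * M₂ * M₃)

/-- Error probability of user 3, for independent, uniformly distributed messages. -/
def errorProb₃ (c : Code X₁ X₂ X₃ Y₁ Y₂ Y₃ N M₁ M₂ M₃)
    (W : Kernel (X₁ × X₂ × X₃) (Y₁ × Y₂ × Y₃)) : ℝ≥0∞ :=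
  (∑ w, c.outputLaw W w {y | c.dec₃ (fun t => (y t).2.2) ≠ w.2.2}) / (M₁ * M₂ * M₃)

/-- The largest of the three error probabilities. -/
def errorProb (c : Code X₁ X₂ X₃ Y₁ Y₂ Y₃ N M₁ M₂ M₃)
    (W : Kernel (X₁ × X₂ × X₃) (Y₁ × Y₂ × Y₃)) : ℝ≥0∞ :=
  max (c.errorProb₁ W) (max (c.errorProb₂ W) (c.errorProb₃ W))

end Code

/-- The number of integers in `[1 : 2 ^ (N R)]`. -/
def numMessages (N : ℕ) (R : ℝ) : ℕ := ⌊(2 : ℝ) ^ ((N : ℝ) * R)⌋₊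

/-- The capacity region: the nonnegative rate triples (in bits per channel use) for which some
sequence of codes, one for each block length, has vanishing error probability. -/
def capacityRegion (W : Kernel (X₁ × X₂ × X₃) (Y₁ × Y₂ × Y₃)) : Set (ℝ × ℝ × ℝ) :=
  {R | 0 ≤ R.1 ∧ 0 ≤ R.2.1 ∧ 0 ≤ R.2.2 ∧
    ∃ c : ∀ N : ℕ, Code X₁ X₂ X₃ Y₁ Y₂ Y₃ N
        (numMessages N R.1) (numMessages N R.2.1) (numMessages N R.2.2),
      Tendsto (fun N => (c N).errorProb W) atTop (𝓝 0)}

/-- The sum-capacity: the supremum of `R₁ + R₂ + R₃` over the capacity region. -/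
def sumCapacity (W : Kernel (X₁ × X₂ × X₃) (Y₁ × Y₂ × Y₃)) : ℝ≥0∞ :=
  ⨆ R ∈ capacityRegion W, ENNReal.ofReal (R.1 + R.2.1 + R.2.2)

/-- The joint law of inputs and outputs for input distribution `P`. -/
abbrev jointLaw (W : Kernel (X₁ × X₂ × X₃) (Y₁ × Y₂ × Y₃)) (P : ProbabilityMeasure (X₁ × X₂ × X₃)) :
    Measure ((X₁ × X₂ × X₃) × (Y₁ × Y₂ × Y₃)) :=
  (P : Measure (X₁ × X₂ × X₃)) ⊗ₘ W

variable [StandardBorelSpace X₁] [StandardBorelSpace X₂] [StandardBorelSpace X₃]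
  [StandardBorelSpace Y₁] [StandardBorelSpace Y₂] [StandardBorelSpace Y₃]
  [Nonempty X₁] [Nonempty X₂] [Nonempty X₃] [Nonempty Y₁] [Nonempty Y₂] [Nonempty Y₃]

/-- `min {I(Y₃; X₃ | X₁, X₂, Y₁), I(Y₃; X₃ | X₁, X₂, Y₂)} + I(Y₁; X₁, X₃ | X₂)
+ I(Y₂; X₂, X₃ | X₁)`. -/
def boundA (W : Kernel (X₁ × X₂ × X₃) (Y₁ × Y₂ × Y₃)) [IsMarkovKernel W]
    (P : ProbabilityMeasure (X₁ × X₂ × X₃)) : ℝ≥0∞ :=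
  min
      (condMutualInfo (fun ω => ω.2.2.2) (fun ω => ω.1.2.2)
        (fun ω => (ω.1.1, ω.1.2.1, ω.2.1)) (jointLaw W P))
      (condMutualInfo (fun ω => ω.2.2.2) (fun ω => ω.1.2.2)
        (fun ω => (ω.1.1, ω.1.2.1, ω.2.2.1)) (jointLaw W P))
    + condMutualInfo (fun ω => ω.2.1) (fun ω => (ω.1.1, ω.1.2.2))
        (fun ω => ω.1.2.1) (jointLaw W P)
    + condMutualInfo (fun ω => ω.2.2.1) (fun ω => (ω.1.2.1, ω.1.2.2))
        (fun ω => ω.1.1) (jointLaw W P)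

/-- `min {I(Y₁; X₁, X₂, X₃) + I(Y₂; X₂, X₃ | X₁, Y₁), I(Y₁; X₁, X₃ | X₂, Y₂) + I(Y₂; X₁, X₂, X₃)}
+ I(Y₃; X₃ | X₂, Y₂, X₁, Y₁)`. -/
def boundB (W : Kernel (X₁ × X₂ × X₃) (Y₁ × Y₂ × Y₃)) [IsMarkovKernel W]
    (P : ProbabilityMeasure (X₁ × X₂ × X₃)) : ℝ≥0∞ :=
  min
      (mutualInfo (fun ω => ω.2.1)
          (fun ω => (ω.1.1, ω.1.2.1, ω.1.2.2)) (jointLaw W P)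
        + condMutualInfo (fun ω => ω.2.2.1)
            (fun ω => (ω.1.2.1, ω.1.2.2))
            (fun ω => (ω.1.1, ω.2.1)) (jointLaw W P))
      (condMutualInfo (fun ω => ω.2.1)
            (fun ω => (ω.1.1, ω.1.2.2))
            (fun ω => (ω.1.2.1, ω.2.2.1)) (jointLaw W P)
        + mutualInfo (fun ω => ω.2.2.1)
            (fun ω => (ω.1.1, ω.1.2.1, ω.1.2.2)) (jointLaw W P))
    + condMutualInfo (fun ω => ω.2.2.2) (fun ω => ω.1.2.2)
        (fun ω => (ω.1.2.1, ω.2.2.1, ω.1.1, ω.2.1)) (jointLaw W P)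

end Channel

end CoMS

end

/-!
Compare the channel with an auxiliary channel in which the outputs are drawn one user at a time,
each from a law that does not see the message of its user, although it may use the outputs drawn
before. The decoders form a test that accepts the true channel with high probability and the
auxiliary channel with probability exactly one over the number of messages. The variational bound
`L μ(A) ≤ D(μ ‖ ν) + e ^ L ν(A)` turns this into an upper bound on the logarithm of the number of
messages: up to `o(N)`, it is at most `N` times the divergence between the two channels averaged
over the empirical law of the input letters. That law does not depend on the auxiliary channel, so
the auxiliary channel can be optimized for it, and conditional laws of the outputs give the mutual
informations in `a(P)` and `b(P)`.

For finite input alphabets, mixing a dominating law into the auxiliary channel makes its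
divergences finite at an arbitrarily small loss. The optimal divergence is therefore an infimum of
continuous functions of `P`, hence upper semicontinuous, and attains its maximum.
-/

open scoped NNReal

namespace CoMS

section Divergence

variable {α β : Type*} [MeasurableSpace α] [MeasurableSpace β]

lemma mul_le_klFun_add_exp (L : ℝ) {r : ℝ} (hr : 0 ≤ r) : L * r ≤ klFun r + Real.exp L := by
  obtain rfl | hr := hr.eq_or_lt
  · simpa only [mul_zero, klFun_zero] using (by positivity : (0 : ℝ) ≤ 1 + Real.exp L)
  have h := Real.add_one_le_exp (L - Real.log r)
  rw [Real.exp_sub, Real.exp_log hr, le_div_iff₀ hr] at h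
  rw [klFun_apply]
  linarith

lemma ofReal_mul_measure_le_klDiv_add (μ ν : Measure α) [IsFiniteMeasure μ] [IsFiniteMeasure ν]
    {A : Set α} (hA : MeasurableSet A) (L : ℝ) :
    ENNReal.ofReal L * μ A ≤ klDiv μ ν + ENNReal.ofReal (Real.exp L) * ν A := by
  by_cases h : μ ≪ ν
  swap
  · simp [klDiv_of_not_ac h]
  have hμA : μ A = ∫⁻ x, A.indicator (μ.rnDeriv ν) x ∂ν := by
    rw [lintegral_indicator hA, Measure.setLIntegral_rnDeriv h]
  rw [klDiv_eq_lintegral_klFun_of_ac h, hμA,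
    ← lintegral_const_mul _ ((Measure.measurable_rnDeriv μ ν).indicator hA),
    ← lintegral_indicator_const hA, ← lintegral_add_left (by fun_prop)]
  refine lintegral_mono_ae ?_
  filter_upwards [μ.rnDeriv_lt_top ν] with x hx
  by_cases hxA : x ∈ A
  · simp only [hxA, Set.indicator_of_mem]
    rw [← ENNReal.ofReal_add (klFun_nonneg ENNReal.toReal_nonneg) (Real.exp_pos _).le]
    conv_lhs => rw [← ENNReal.ofReal_toReal hx.ne, ← ENNReal.ofReal_mul' ENNReal.toReal_nonneg]
    exact ENNReal.ofReal_le_ofReal (mul_le_klFun_add_exp L ENNReal.toReal_nonneg)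
  · simp [hxA]

lemma rnDeriv_le_inv_of_smul_le {ν ν' : Measure α} [IsFiniteMeasure ν'] {c : ℝ≥0}
    (hc : c ≠ 0) (h : c • ν ≤ ν') : ν.rnDeriv ν' ≤ᵐ[ν'] fun _ => (c : ℝ≥0∞)⁻¹ := by
  refine ae_le_of_forall_setLIntegral_le_of_sigmaFinite (by fun_prop) fun s _ _ => ?_
  rw [setLIntegral_const, mul_comm, ← div_eq_mul_inv]
  refine (Measure.setLIntegral_rnDeriv_le s).trans (ENNReal.le_div_iff_mul_le ?_ ?_ |>.2 ?_)
  · simp [hc]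
  · simp
  · rw [mul_comm]
    exact h s

lemma klFun_mul_add_le {f g ℓ : ℝ} (hf : 0 ≤ f) (hg : 0 < g) (hℓ : Real.log g ≤ ℓ) :
    klFun (f * g) + g ≤ g * klFun f + f * g * ℓ + 1 := by
  obtain rfl | hf := hf.eq_or_lt
  · simp [klFun_zero, add_comm]
  · rw [klFun_apply, klFun_apply, Real.log_mul hf.ne' hg.ne']
    linarith [mul_le_mul_of_nonneg_left hℓ (mul_pos hf hg).le]

lemma ofReal_klFun_mul_add_le {f g : ℝ≥0∞} (hg : g ≠ ∞) (hfg : f * g ≠ ∞) {c : ℝ≥0}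
    (hc : c ≠ 0) (hc₁ : c ≤ 1) (h : g ≤ (c : ℝ≥0∞)⁻¹) :
    ENNReal.ofReal (klFun (f * g).toReal) + g
      ≤ g * ENNReal.ofReal (klFun f.toReal) + f * g * ENNReal.ofReal (-Real.log c) + 1 := by
  obtain rfl | hg₀ := eq_or_ne g 0
  · simp [klFun_zero]
  have hf : f ≠ ∞ := by
    rintro rfl
    simp [hg₀] at hfg
  lift f to ℝ≥0 using hf
  lift g to ℝ≥0 using hg
  have hg_pos : (0 : ℝ) < g := by simpa [pos_iff_ne_zero] using hg₀
  have hlog : Real.log g ≤ -Real.log c := by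
    rw [← Real.log_inv]
    rw [← ENNReal.coe_inv hc, ENNReal.coe_le_coe] at h
    exact Real.log_le_log hg_pos (by exact_mod_cast h)
  have hc_log : 0 ≤ -Real.log c := neg_nonneg.2 (Real.log_nonpos c.2 (by exact_mod_cast hc₁))
  have hf_kl : 0 ≤ klFun (f : ℝ) := klFun_nonneg f.2
  have hfg_kl : 0 ≤ klFun (f * g : ℝ) := klFun_nonneg (by positivity)
  rw [← ENNReal.coe_mul, ENNReal.coe_toReal, ENNReal.coe_toReal, NNReal.coe_mul,
    ← ENNReal.ofReal_coe_nnreal (p := g), ← ENNReal.ofReal_coe_nnreal (p := f * g),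
    NNReal.coe_mul, ← ENNReal.ofReal_one, ← ENNReal.ofReal_mul hg_pos.le,
    ← ENNReal.ofReal_mul (by positivity), ← ENNReal.ofReal_add hfg_kl hg_pos.le,
    ← ENNReal.ofReal_add (by positivity) (by positivity),
    ← ENNReal.ofReal_add (by positivity) zero_le_one]
  exact ENNReal.ofReal_le_ofReal (klFun_mul_add_le f.2 hg_pos hlog)

lemma klDiv_le_add_of_smul_le (μ ν ν' : Measure α) [IsProbabilityMeasure μ]
    [IsProbabilityMeasure ν] [IsProbabilityMeasure ν'] {c : ℝ≥0} (hc : c ≠ 0) (h : c • ν ≤ ν') :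
    klDiv μ ν' ≤ klDiv μ ν + ENNReal.ofReal (-Real.log c) := by
  by_cases hμν : μ ≪ ν
  swap
  · simp [klDiv_of_not_ac hμν]
  have hc₁ : c ≤ 1 := by
    have := h Set.univ
    rw [Measure.smul_apply, measure_univ, measure_univ] at this
    simpa [ENNReal.smul_def] using this
  have hνν' : ν ≪ ν' := (Measure.absolutelyContinuous_smul (by simpa using hc)).trans
    (Measure.absolutelyContinuous_of_le h)
  have hμν' := hμν.trans hνν'
  -- Adding `1 = ∫⁻ x, ν.rnDeriv ν' x ∂ν'` allows a pointwise comparison of the integrands.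
  refine (ENNReal.add_le_add_iff_right ENNReal.one_ne_top).1 ?_
  calc klDiv μ ν' + 1
      = ∫⁻ x, (ENNReal.ofReal (klFun (μ.rnDeriv ν' x).toReal) + ν.rnDeriv ν' x) ∂ν' := by
        rw [klDiv_eq_lintegral_klFun_of_ac hμν', lintegral_add_left (by fun_prop),
          Measure.lintegral_rnDeriv hνν', measure_univ]
    _ ≤ ∫⁻ x, (ν.rnDeriv ν' x * ENNReal.ofReal (klFun (μ.rnDeriv ν x).toReal)
          + μ.rnDeriv ν' x * ENNReal.ofReal (-Real.log c) + 1) ∂ν' := by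
        refine lintegral_mono_ae ?_
        filter_upwards [Measure.rnDeriv_mul_rnDeriv (κ := ν') hμν,
          rnDeriv_le_inv_of_smul_le hc h, μ.rnDeriv_lt_top ν', ν.rnDeriv_lt_top ν']
          with x h_mul h_le h_top h_top'
        rw [← h_mul, Pi.mul_apply] at h_top ⊢
        exact ofReal_klFun_mul_add_le h_top'.ne h_top.ne hc hc₁ h_le
    _ = klDiv μ ν + ENNReal.ofReal (-Real.log c) + 1 := by
        rw [lintegral_add_right _ (by fun_prop), lintegral_add_right _ (by fun_prop),
          lintegral_rnDeriv_mul hνν' (by fun_prop), ← klDiv_eq_lintegral_klFun_of_ac hμν,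
          lintegral_mul_const _ (by fun_prop), Measure.lintegral_rnDeriv hμν', measure_univ,
          one_mul, lintegral_one, measure_univ]

lemma klDiv_map_measurableEquiv (e : α ≃ᵐ β) (μ ν : Measure α) [IsFiniteMeasure μ]
    [IsFiniteMeasure ν] : klDiv (μ.map e) (ν.map e) = klDiv μ ν := by
  refine (klDiv_map_le μ ν e.measurable).antisymm ?_
  simpa using klDiv_map_le (μ.map e) (ν.map e) e.symm.measurable

lemma klDiv_prod (μ μ' : Measure α) (ν ν' : Measure β) [IsProbabilityMeasure μ]
    [IsProbabilityMeasure μ'] [IsProbabilityMeasure ν] [IsProbabilityMeasure ν'] :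
    klDiv (μ.prod ν) (μ'.prod ν') = klDiv μ μ' + klDiv ν ν' := by
  have h : klDiv (μ.prod ν) (μ.prod ν') = klDiv ν ν' := by
    rw [← klDiv_map_measurableEquiv MeasurableEquiv.prodComm]
    simp only [MeasurableEquiv.prodComm, MeasurableEquiv.coe_mk, Equiv.coe_prodComm,
      Measure.prod_swap]
    rw [← Measure.compProd_const, ← Measure.compProd_const, klDiv_compProd_left]
  rw [← h, ← Measure.compProd_const, ← Measure.compProd_const, ← Measure.compProd_const,
    klDiv_compProd_eq_add]

lemma klDiv_pi {n : ℕ} (μ ν : Fin n → Measure α) [∀ i, IsProbabilityMeasure (μ i)]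
    [∀ i, IsProbabilityMeasure (ν i)] :
    klDiv (Measure.pi μ) (Measure.pi ν) = ∑ i, klDiv (μ i) (ν i) := by
  induction n with
  | zero => simp [Measure.pi_of_empty _ (fun i : Fin 0 => i.elim0)]
  | succ n ih =>
    rw [← klDiv_map_measurableEquiv (MeasurableEquiv.piFinSuccAbove (fun _ => α) 0),
      (measurePreserving_piFinSuccAbove μ 0).map_eq, (measurePreserving_piFinSuccAbove ν 0).map_eq,
      klDiv_prod, ih, Fin.sum_univ_succ]
    simp only [Fin.zero_succAbove]

lemma rnDeriv_compProd_right [MeasurableSpace.CountableOrCountablyGenerated α β] {P : Measure α}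
    [IsFiniteMeasure P] {K Q : Kernel α β} [IsFiniteKernel K] [IsFiniteKernel Q]
    (h : ∀ᵐ x ∂P, K x ≪ Q x) :
    (P ⊗ₘ K).rnDeriv (P ⊗ₘ Q) =ᵐ[P ⊗ₘ Q] fun p => K.rnDeriv Q p.1 p.2 := by
  have hm : Measurable fun p : α × β => K.rnDeriv Q p.1 p.2 := Kernel.measurable_rnDeriv K Q
  have hK : K =ᵐ[P] Q.withDensity (K.rnDeriv Q) := by
    filter_upwards [h] with x hx
    rw [Kernel.withDensity_rnDeriv_eq hx]
  rw [Measure.compProd_congr hK, Measure.compProd_withDensity hm]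
  exact Measure.rnDeriv_withDensity _ hm

lemma klDiv_compProd_right [MeasurableSpace.CountableOrCountablyGenerated α β] (P : Measure α)
    [IsFiniteMeasure P] (K Q : Kernel α β) [IsFiniteKernel K] [IsFiniteKernel Q] :
    klDiv (P ⊗ₘ K) (P ⊗ₘ Q) = ∫⁻ x, klDiv (K x) (Q x) ∂P := by
  by_cases h : ∀ᵐ x ∂P, K x ≪ Q x
  · rw [klDiv_eq_lintegral_klFun_of_ac (Measure.absolutelyContinuous_compProd_right_iff.2 h),
      lintegral_congr_ae ((rnDeriv_compProd_right h).mono fun p hp => by rw [hp]),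
      Measure.lintegral_compProd (by fun_prop)]
    refine lintegral_congr_ae ?_
    filter_upwards [h] with x hx
    rw [klDiv_eq_lintegral_klFun_of_ac hx]
    refine lintegral_congr_ae ?_
    filter_upwards [Kernel.rnDeriv_eq_rnDeriv_measure (κ := K) (η := Q) (a := x)] with y hy
    rw [hy]
  · rw [klDiv_of_not_ac (mt Measure.absolutelyContinuous_compProd_right_iff.1 h), eq_comm,
      eq_top_iff]
    have hs : MeasurableSet {x | ¬ K x ≪ Q x} :=
      (Kernel.measurableSet_absolutelyContinuous K Q).compl
    calc (∞ : ℝ≥0∞) = ∫⁻ _ in {x | ¬ K x ≪ Q x}, ∞ ∂P := by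
          rw [setLIntegral_const, ENNReal.top_mul (mt ae_iff.2 h)]
      _ ≤ ∫⁻ x in {x | ¬ K x ≪ Q x}, klDiv (K x) (Q x) ∂P :=
          setLIntegral_mono' hs fun _ hx => (klDiv_of_not_ac hx).ge
      _ ≤ ∫⁻ x, klDiv (K x) (Q x) ∂P := setLIntegral_le_lintegral _ _

end Divergence

section Families

variable {α β γ δ τ : Type*} [MeasurableSpace α] [MeasurableSpace β] [MeasurableSpace γ]
  [MeasurableSpace δ] [MeasurableSpace τ]

/-- The Markov kernels from `τ` to `α` whose value at `x` is a measurable function of `f x`. -/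
def kernelsThrough (f : τ → γ) (α : Type*) [MeasurableSpace α] : Set (Kernel τ α) :=
  {Q | ∃ q : Kernel γ α, IsMarkovKernel q ∧ ∀ x, Q x = q (f x)}

/-- The sequential kernels: a first output drawn from a kernel in `S`, then a second output whose
law depends on the input and the first output only through `g`. -/
def sequentialKernels (S : Set (Kernel τ α)) (g : τ × α → δ) (β : Type*) [MeasurableSpace β] :
    Set (Kernel τ (α × β)) :=
  {Q | ∃ Q₀ ∈ S, ∃ Q₁ ∈ kernelsThrough g β, Q = Q₀ ⊗ₖ Q₁}

lemma isMarkovKernel_of_mem_kernelsThrough {f : τ → γ} {Q : Kernel τ α}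
    (hQ : Q ∈ kernelsThrough f α) : IsMarkovKernel Q := by
  obtain ⟨q, hq, h⟩ := hQ
  exact ⟨fun x => by rw [h]; infer_instance⟩

lemma isMarkovKernel_of_mem_sequentialKernels {S : Set (Kernel τ α)}
    (hS : ∀ Q ∈ S, IsMarkovKernel Q) {g : τ × α → δ} {Q : Kernel τ (α × β)}
    (hQ : Q ∈ sequentialKernels S g β) : IsMarkovKernel Q := by
  obtain ⟨Q₀, h₀, Q₁, h₁, rfl⟩ := hQ
  have := hS _ h₀
  have := isMarkovKernel_of_mem_kernelsThrough h₁
  infer_instance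

lemma apply_eq_of_mem_kernelsThrough {f : τ → γ} {Q : Kernel τ α}
    (hQ : Q ∈ kernelsThrough f α) {x x' : τ} (h : f x = f x') : Q x = Q x' := by
  obtain ⟨q, -, hq⟩ := hQ
  rw [hq, hq, h]

lemma compProd_apply_congr {Q₀ : Kernel τ α} {Q₁ : Kernel (τ × α) β} [IsSFiniteKernel Q₀]
    [IsSFiniteKernel Q₁] {x x' : τ} (h₀ : Q₀ x = Q₀ x') (h₁ : ∀ a, Q₁ (x, a) = Q₁ (x', a)) :
    (Q₀ ⊗ₖ Q₁) x = (Q₀ ⊗ₖ Q₁) x' := by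
  ext s hs
  simp_rw [Kernel.compProd_apply hs, h₀, h₁]

lemma compProd_map_fst_apply (Q₀ : Kernel τ α) (Q₁ : Kernel (τ × α) β) [IsSFiniteKernel Q₀]
    [IsMarkovKernel Q₁] (x : τ) : ((Q₀ ⊗ₖ Q₁) x).map Prod.fst = Q₀ x := by
  rw [← Kernel.map_apply _ measurable_fst, ← Kernel.fst_eq, Kernel.fst_compProd]

end Families

section Domination

variable {α β γ δ τ : Type*} [MeasurableSpace α] [MeasurableSpace β] [MeasurableSpace γ]
  [MeasurableSpace δ] [MeasurableSpace τ]

/-- The mixture of the kernels `κ` and `η` with weights `c` and `1 - c`, where `c ≤ 1`. -/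
noncomputable def mixture (c : ℝ≥0) (κ η : Kernel τ α) : Kernel τ α where
  toFun x := c • κ x + (1 - c) • η x
  measurable' := by
    refine Measure.measurable_of_measurable_coe _ fun s hs => ?_
    simp only [Measure.coe_add, Measure.coe_nnreal_smul_apply, Pi.add_apply]
    exact ((κ.measurable_coe hs).const_mul _).add ((η.measurable_coe hs).const_mul _)

lemma mixture_apply (c : ℝ≥0) (κ η : Kernel τ α) (x : τ) :
    mixture c κ η x = c • κ x + (1 - c) • η x := rfl

lemma isMarkovKernel_mixture {c : ℝ≥0} (hc : c ≤ 1) (κ η : Kernel τ α) [IsMarkovKernel κ]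
    [IsMarkovKernel η] : IsMarkovKernel (mixture c κ η) := ⟨fun x => ⟨by
  rw [mixture_apply, Measure.add_apply, Measure.coe_nnreal_smul_apply,
    Measure.coe_nnreal_smul_apply, measure_univ, measure_univ, mul_one, mul_one]
  exact_mod_cast add_tsub_cancel_of_le hc⟩⟩

lemma exists_mem_kernelsThrough_smul_le {f : τ → γ} (hf : Measurable f) {Q : Kernel τ α}
    (hQ : Q ∈ kernelsThrough f α) (κ : Kernel γ α) [IsMarkovKernel κ] {c : ℝ≥0} (hc : c ≤ 1) :
    ∃ Q' ∈ kernelsThrough f α, ∀ x, c • Q x ≤ Q' x ∧ (1 - c) • κ (f x) ≤ Q' x := by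
  obtain ⟨q, hq, h⟩ := hQ
  have := isMarkovKernel_mixture hc q κ
  refine ⟨(mixture c q κ).comap f hf, ⟨_, this, fun _ => rfl⟩, fun x => ?_⟩
  rw [Kernel.comap_apply, mixture_apply, h]
  exact ⟨Measure.le_add_right le_rfl, Measure.le_add_left le_rfl⟩

lemma smul_compProd_apply_le {c d : ℝ≥0} {Q₀ Q₀' : Kernel τ α} {Q₁ Q₁' : Kernel (τ × α) β}
    [IsSFiniteKernel Q₀] [IsSFiniteKernel Q₀'] [IsSFiniteKernel Q₁] [IsSFiniteKernel Q₁'] {x : τ}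
    (h₀ : c • Q₀ x ≤ Q₀' x) (h₁ : ∀ a, d • Q₁ (x, a) ≤ Q₁' (x, a)) :
    (c * d) • (Q₀ ⊗ₖ Q₁) x ≤ (Q₀' ⊗ₖ Q₁') x := by
  refine Measure.le_iff.2 fun s hs => ?_
  have hm : Measurable fun a => Q₁ (x, a) (Prod.mk a ⁻¹' s) :=
    Kernel.measurable_kernel_prodMk_left' (η := Q₁) hs x
  calc ((c * d) • (Q₀ ⊗ₖ Q₁) x) s
      = ∫⁻ a, (d • Q₁ (x, a)) (Prod.mk a ⁻¹' s) ∂(c • Q₀ x) := by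
        simp only [Measure.coe_nnreal_smul_apply]
        rw [Kernel.compProd_apply hs, lintegral_const_mul _ hm, lintegral_smul_measure,
          ENNReal.smul_def, smul_eq_mul, ENNReal.coe_mul, mul_comm (c : ℝ≥0∞), mul_assoc]
    _ ≤ ∫⁻ a, Q₁' (x, a) (Prod.mk a ⁻¹' s) ∂Q₀' x := lintegral_mono' h₀ fun a => h₁ a _
    _ = (Q₀' ⊗ₖ Q₁') x s := (Kernel.compProd_apply hs _ _ _).symm

/-- A family of Markov kernels each of which can be perturbed within the family, at an arbitrarily
small multiplicative loss, so as to dominate a multiple of any given law. -/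
structure IsDominable (S : Set (Kernel τ α)) : Prop where
  isMarkovKernel : ∀ Q ∈ S, IsMarkovKernel Q
  exists_smul_le : ∀ Q ∈ S, ∀ ν : Measure α, IsProbabilityMeasure ν → ∀ c : ℝ≥0, c < 1 →
    ∃ Q' ∈ S, ∃ d : ℝ≥0, d ≠ 0 ∧ ∀ x, c • Q x ≤ Q' x ∧ d • ν ≤ Q' x

lemma isDominable_kernelsThrough {f : τ → γ} (hf : Measurable f) :
    IsDominable (kernelsThrough f α) where
  isMarkovKernel _ := isMarkovKernel_of_mem_kernelsThrough
  exists_smul_le _ hQ ν _ c hc := by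
    obtain ⟨Q', hQ', h⟩ := exists_mem_kernelsThrough_smul_le hf hQ (Kernel.const γ ν) hc.le
    exact ⟨Q', hQ', 1 - c, (tsub_pos_of_lt hc).ne', h⟩

lemma IsDominable.sequentialKernels [StandardBorelSpace β] [Nonempty β] {S : Set (Kernel τ α)}
    (hS : IsDominable S) {g : τ × α → δ} (hg : Measurable g) {r : δ → α} (hr : Measurable r)
    (hrg : ∀ p, r (g p) = p.2) : IsDominable (sequentialKernels S g β) where
  isMarkovKernel _ := isMarkovKernel_of_mem_sequentialKernels hS.isMarkovKernel
  exists_smul_le := by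
    rintro _ ⟨Q₀, h₀, Q₁, h₁, rfl⟩ ν hν c hc
    have hc' : NNReal.sqrt c < 1 := by simpa using NNReal.sqrt_lt_sqrt.2 hc
    obtain ⟨Q₀', h₀', d, hd, H₀⟩ := hS.exists_smul_le Q₀ h₀ ν.fst inferInstance _ hc'
    obtain ⟨Q₁', h₁', H₁⟩ := exists_mem_kernelsThrough_smul_le hg h₁ (ν.condKernel.comap r hr)
      hc'.le
    have := hS.isMarkovKernel _ h₀
    have := hS.isMarkovKernel _ h₀'
    have := isMarkovKernel_of_mem_kernelsThrough h₁
    have := isMarkovKernel_of_mem_kernelsThrough h₁'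
    refine ⟨Q₀' ⊗ₖ Q₁', ⟨Q₀', h₀', Q₁', h₁', rfl⟩, d * (1 - NNReal.sqrt c),
      mul_ne_zero hd (tsub_pos_of_lt hc').ne', fun x => ⟨?_, ?_⟩⟩
    · rw [← NNReal.mul_self_sqrt c]
      exact smul_compProd_apply_le (H₀ x).1 fun a => (H₁ (x, a)).1
    · have hν_eq :
          (Kernel.const τ ν.fst ⊗ₖ ν.condKernel.comap Prod.snd measurable_snd) x = ν := by
        conv_rhs => rw [← ν.disintegrate ν.condKernel]
        ext s hs
        rw [Kernel.compProd_apply hs, Measure.compProd_apply hs]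
        rfl
      conv_lhs => rw [← hν_eq]
      refine smul_compProd_apply_le (H₀ x).2 fun a => ?_
      simpa only [Kernel.comap_apply, hrg] using (H₁ (x, a)).2

lemma exists_probabilityMeasure_forall_smul_le [Finite τ] [Nonempty τ] (K : Kernel τ α)
    [IsMarkovKernel K] :
    ∃ ν : Measure α, IsProbabilityMeasure ν ∧ ∃ c : ℝ≥0, c ≠ 0 ∧ ∀ x, c • K x ≤ ν := by
  cases nonempty_fintype τ
  have hcard : (Fintype.card τ : ℝ≥0) ≠ 0 := by simp
  refine ⟨(Fintype.card τ : ℝ≥0)⁻¹ • ∑ x, K x, ⟨?_⟩, (Fintype.card τ : ℝ≥0)⁻¹,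
    inv_ne_zero hcard, fun x => ?_⟩
  · simp only [Measure.coe_nnreal_smul_apply, Measure.finsetSum_apply, measure_univ,
      Finset.sum_const, Finset.card_univ, nsmul_eq_mul, mul_one]
    exact_mod_cast inv_mul_cancel₀ hcard
  · refine Measure.le_iff.2 fun s _ => ?_
    simp only [Measure.coe_nnreal_smul_apply, Measure.finsetSum_apply]
    gcongr
    exact Finset.single_le_sum (f := fun x => K x s) (fun _ _ => zero_le) (Finset.mem_univ x)

lemma klDiv_ne_top_of_smul_le (μ ν : Measure α) [IsProbabilityMeasure μ] [IsProbabilityMeasure ν]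
    {c : ℝ≥0} (hc : c ≠ 0) (h : c • μ ≤ ν) : klDiv μ ν ≠ ∞ := by
  have := klDiv_le_add_of_smul_le μ μ ν hc h
  rw [klDiv_self, zero_add] at this
  exact (this.trans_lt ENNReal.ofReal_lt_top).ne

lemma IsDominable.exists_klDiv_ne_top [Finite τ] [Nonempty τ] {S : Set (Kernel τ α)}
    (hS : IsDominable S) (K : Kernel τ α) [IsMarkovKernel K] {Q : Kernel τ α} (hQ : Q ∈ S)
    {η : ℝ≥0} (hη : 0 < η) :
    ∃ Q' ∈ S, ∀ x, klDiv (K x) (Q' x) ≠ ∞ ∧ klDiv (K x) (Q' x) ≤ klDiv (K x) (Q x) + η := by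
  obtain ⟨ν, hν, c, hc, hK⟩ := exists_probabilityMeasure_forall_smul_le K
  have he : Real.toNNReal (Real.exp (-η)) < 1 := by simpa using hη
  obtain ⟨Q', hQ', d, hd, H⟩ := hS.exists_smul_le Q hQ ν hν _ he
  have := hS.isMarkovKernel _ hQ
  have := hS.isMarkovKernel _ hQ'
  refine ⟨Q', hQ', fun x => ⟨?_, ?_⟩⟩
  · refine klDiv_ne_top_of_smul_le (K x) (Q' x) (mul_ne_zero hd hc) (le_trans ?_ (H x).2)
    rw [mul_smul]
    exact Measure.le_iff.2 fun s _ => mul_le_mul_right (hK x s) (d : ℝ≥0∞)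
  · have h := klDiv_le_add_of_smul_le (K x) (Q x) (Q' x) (by simpa using Real.exp_pos _) (H x).1
    rwa [Real.coe_toNNReal _ (Real.exp_pos _).le, Real.log_exp, neg_neg,
      ENNReal.ofReal_coe_nnreal] at h

end Domination

section InfKlDiv

variable {Ω τ α β γ δ : Type*} [MeasurableSpace Ω] [MeasurableSpace τ] [MeasurableSpace α]
  [MeasurableSpace β] [MeasurableSpace γ] [MeasurableSpace δ]

/-- The least divergence of the joint law of `(T, U)` under `μ` from the laws obtained by
replacing the conditional law of `U` given `T` by a kernel of `S`. -/
noncomputable def infKlDiv (T : Ω → τ) (U : Ω → α) (S : Set (Kernel τ α)) (μ : Measure Ω) :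
    ℝ≥0∞ :=
  ⨅ Q ∈ S, klDiv (μ.map fun ω => (T ω, U ω)) (μ.map T ⊗ₘ Q)

lemma log_two_ne_zero : ENNReal.ofReal (Real.log 2) ≠ 0 := by
  simp [Real.log_pos]

lemma map_compProd_prod (P : Measure γ) [SFinite P] (κ : Kernel γ α) [IsSFiniteKernel κ]
    (η : Kernel γ β) [IsSFiniteKernel η] {f : τ → γ} (hf : Measurable f) {r : γ × β → τ}
    (hr : Measurable r) (hfr : ∀ p, f (r p) = p.1) :
    (P ⊗ₘ (κ ×ₖ η)).map (fun p => (r (p.1, p.2.2), p.2.1))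
      = (P ⊗ₘ η).map r ⊗ₘ κ.comap f hf := by
  refine Measure.ext_of_lintegral _ fun F hF => ?_
  have hFκ : Measurable fun t => ∫⁻ u, F (t, u) ∂κ.comap f hf t := hF.lintegral_kernel_prod_right'
  have hFκr : Measurable fun p => ∫⁻ u, F (r p, u) ∂κ.comap f hf (r p) := hFκ.comp hr
  rw [lintegral_map hF (by fun_prop), Measure.lintegral_compProd (by fun_prop),
    Measure.lintegral_compProd hF, lintegral_map hFκ hr, Measure.lintegral_compProd hFκr]
  refine lintegral_congr fun z => ?_
  rw [Kernel.prod_apply, lintegral_prod_symm _ (by fun_prop)]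
  simp only [Kernel.comap_apply, hfr]

variable (μ : Measure Ω) [IsProbabilityMeasure μ]

lemma infKlDiv_kernelsThrough_le_condMutualInfo [StandardBorelSpace α] [Nonempty α]
    [StandardBorelSpace β] [Nonempty β] {T : Ω → τ} {U : Ω → α} (hT : Measurable T)
    (hU : Measurable U) {f : τ → γ} (hf : Measurable f) {h : τ → β} (hh : Measurable h)
    {r : γ × β → τ} (hr : Measurable r) (hfr : ∀ p, f (r p) = p.1)
    (hrfh : ∀ t, r (f t, h t) = t) :
    infKlDiv T U (kernelsThrough f α) μ
      ≤ condMutualInfo U (fun ω => h (T ω)) (fun ω => f (T ω)) μ * ENNReal.ofReal (Real.log 2) := by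
  set Z := fun ω => f (T ω)
  set V := fun ω => h (T ω)
  have hZ : Measurable Z := hf.comp hT
  have hV : Measurable V := hh.comp hT
  set Q := (condDistrib U Z μ).comap f hf
  have hQ : Q ∈ kernelsThrough f α := ⟨_, inferInstance, fun _ => rfl⟩
  have hg : Measurable fun p : γ × α × β => (r (p.1, p.2.2), p.2.1) := by fun_prop
  have h_joint : (μ.map fun ω => (Z ω, (U ω, V ω))).map (fun p => (r (p.1, p.2.2), p.2.1))
      = μ.map fun ω => (T ω, U ω) := by
    rw [Measure.map_map hg (by fun_prop)]
    simp only [Function.comp_def, Z, V, hrfh]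
  have h_input : (μ.map Z ⊗ₘ condDistrib V Z μ).map r = μ.map T := by
    rw [compProd_map_condDistrib hV.aemeasurable, Measure.map_map hr (by fun_prop)]
    simp only [Function.comp_def, Z, V, hrfh]
  have : IsProbabilityMeasure (μ.map Z) := Measure.isProbabilityMeasure_map hZ.aemeasurable
  have h_prod : (μ.map Z ⊗ₘ (condDistrib U Z μ ×ₖ condDistrib V Z μ)).map
      (fun p => (r (p.1, p.2.2), p.2.1)) = μ.map T ⊗ₘ Q := by
    rw [map_compProd_prod _ _ _ hf hr hfr, h_input]
  rw [condMutualInfo, ENNReal.div_mul_cancel log_two_ne_zero ENNReal.ofReal_ne_top]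
  refine (iInf₂_le Q hQ).trans ?_
  rw [← h_joint, ← h_prod]
  exact klDiv_map_le _ _ hg

lemma infKlDiv_kernelsThrough_const_le_mutualInfo {T : Ω → τ} {U : Ω → α} (hT : Measurable T)
    (hU : Measurable U) :
    infKlDiv T U (kernelsThrough (fun _ => ()) α) μ
      ≤ mutualInfo U T μ * ENNReal.ofReal (Real.log 2) := by
  have : IsProbabilityMeasure (μ.map U) := Measure.isProbabilityMeasure_map hU.aemeasurable
  have : IsProbabilityMeasure (μ.map T) := Measure.isProbabilityMeasure_map hT.aemeasurable
  have h_swap : μ.map (fun ω => (T ω, U ω)) = (μ.map fun ω => (U ω, T ω)).map Prod.swap := by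
    rw [Measure.map_map measurable_swap (by fun_prop)]
    rfl
  rw [mutualInfo, ENNReal.div_mul_cancel log_two_ne_zero ENNReal.ofReal_ne_top]
  refine (iInf₂_le (Kernel.const τ (μ.map U)) ⟨Kernel.const Unit (μ.map U), inferInstance,
    fun _ => rfl⟩).trans ?_
  rw [Measure.compProd_const, ← Measure.prod_swap, h_swap]
  exact klDiv_map_le _ _ measurable_swap

lemma infKlDiv_sequentialKernels_le [StandardBorelSpace β] [Nonempty β] {T : Ω → τ}
    {U₀ : Ω → α} {U₁ : Ω → β} (hT : Measurable T) (hU₀ : Measurable U₀) (hU₁ : Measurable U₁)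
    {S : Set (Kernel τ α)} (hS : ∀ Q ∈ S, IsMarkovKernel Q) (g : τ × α → δ) :
    infKlDiv T (fun ω => (U₀ ω, U₁ ω)) (sequentialKernels S g β) μ
      ≤ infKlDiv T U₀ S μ
        + infKlDiv (fun ω => (T ω, U₀ ω)) U₁ (kernelsThrough g β) μ := by
  refine ENNReal.le_iInf₂_add_iInf₂ fun Q₀ hQ₀ Q₁ hQ₁ => ?_
  have := hS _ hQ₀
  have := isMarkovKernel_of_mem_kernelsThrough hQ₁
  have : IsProbabilityMeasure (μ.map T) := Measure.isProbabilityMeasure_map hT.aemeasurable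
  have h_assoc : (μ.map fun ω => (T ω, (U₀ ω, U₁ ω)))
      = (μ.map fun ω => ((T ω, U₀ ω), U₁ ω)).map MeasurableEquiv.prodAssoc := by
    rw [Measure.map_map (by fun_prop) (by fun_prop)]
    rfl
  refine (iInf₂_le (Q₀ ⊗ₖ Q₁) ⟨Q₀, hQ₀, Q₁, hQ₁, rfl⟩).trans_eq ?_
  rw [← Measure.compProd_assoc', h_assoc, klDiv_map_measurableEquiv,
    ← compProd_map_condDistrib (by fun_prop), klDiv_compProd_eq_add,
    compProd_map_condDistrib (by fun_prop)]

lemma infKlDiv_compProd [MeasurableSpace.CountableOrCountablyGenerated τ α] (P : Measure τ)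
    [IsProbabilityMeasure P] (W : Kernel τ β) [IsMarkovKernel W] {u : β → α} (hu : Measurable u)
    {S : Set (Kernel τ α)} (hS : ∀ Q ∈ S, IsMarkovKernel Q) :
    infKlDiv Prod.fst (fun p => u p.2) S (P ⊗ₘ W)
      = ⨅ Q ∈ S, ∫⁻ x, klDiv (W.map u x) (Q x) ∂P := by
  have h_map : (P ⊗ₘ W).map (fun p => (p.1, u p.2)) = P ⊗ₘ W.map u :=
    (Measure.compProd_map hu).symm
  have := Kernel.IsMarkovKernel.map W hu
  refine biInf_congr fun Q hQ => ?_
  have := hS Q hQ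
  rw [h_map, ← Measure.fst, Measure.fst_compProd, klDiv_compProd_right]

end InfKlDiv

section Testing

variable {τ α β γ ι σ : Type*} [MeasurableSpace τ] [MeasurableSpace α] [MeasurableSpace β]
  [MeasurableSpace γ] {N M M' : ℕ}

lemma sum_measure_fiber_inter [Fintype ι] [MeasurableSpace ι] [MeasurableSingletonClass ι]
    (ν : Measure α) (E : Set α) {d : α → ι} (hd : Measurable d) :
    ∑ i, ν (d ⁻¹' {i} ∩ E) = ν E := by
  have h := sum_measure_preimage_singleton (μ := ν.restrict E) (Finset.univ : Finset ι) (f := d)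
    fun i _ => hd (measurableSet_singleton i)
  simpa only [Measure.restrict_apply (hd (measurableSet_singleton _)), Finset.coe_univ,
    Set.preimage_univ, Measure.restrict_apply_univ] using h

lemma pi_map_comp (μ : Fin N → Measure β) [∀ t, IsProbabilityMeasure (μ t)] {u : β → α}
    (hu : Measurable u) :
    (Measure.pi μ).map (fun y t => u (y t)) = Measure.pi fun t => (μ t).map u := by
  have (t : Fin N) : IsProbabilityMeasure ((μ t).map u) :=
    Measure.isProbabilityMeasure_map hu.aemeasurable
  exact Measure.pi_map_pi fun _ => hu.aemeasurable

/-- The empirical law of the family of input blocks `x`. -/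
noncomputable def empirical [Fintype σ] (x : σ → Fin N → τ) : Measure τ :=
  ((N : ℝ≥0∞) * Fintype.card σ)⁻¹ • ∑ s, ∑ t, Measure.dirac (x s t)

lemma isProbabilityMeasure_empirical [Fintype σ] [Nonempty σ] [NeZero N] (x : σ → Fin N → τ) :
    IsProbabilityMeasure (empirical x) := ⟨by
  simp only [empirical, Measure.smul_apply, Measure.finsetSum_apply, measure_univ,
    Finset.sum_const, Finset.card_univ, Fintype.card_fin, nsmul_eq_mul, mul_one, smul_eq_mul]
  rw [mul_comm (N : ℝ≥0∞)]
  exact ENNReal.inv_mul_cancel (by simp [NeZero.ne N]) (by finiteness)⟩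

lemma sum_sum_eq_lintegral_empirical [MeasurableSingletonClass τ] [Fintype σ] [Nonempty σ]
    [NeZero N] (x : σ → Fin N → τ) (f : τ → ℝ≥0∞) :
    ∑ s, ∑ t, f (x s t) = Fintype.card σ * (N * ∫⁻ y, f y ∂empirical x) := by
  rw [empirical, lintegral_smul_measure, lintegral_finsetSum_measure]
  simp_rw [lintegral_finsetSum_measure, lintegral_dirac]
  rw [smul_eq_mul, ← mul_assoc, ← mul_assoc, mul_comm (Fintype.card σ : ℝ≥0∞),
    ENNReal.mul_inv_cancel (by simp [NeZero.ne N]) (by finiteness), one_mul]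

/-- A user who decodes one of the messages in `Fin M` that make up a message tuple in `σ`, from
`N` letters of the component `output` of the channel output in `β`. Here `resample s m` is the
tuple `s` with the user's message replaced by `m`. -/
structure Receiver (σ β γ : Type*) [MeasurableSpace β] [MeasurableSpace γ] (N M : ℕ) where
  message : σ → Fin M
  resample : σ → Fin M → σ
  output : β → γ
  decode : (Fin N → γ) → Fin M
  measurable_output : Measurable output
  measurable_decode : Measurable decode
  message_resample : ∀ s m, message (resample s m) = m
  resample_message : ∀ s, resample s (message s) = s
  resample_resample : ∀ s m m', resample (resample s m) m' = resample s m'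

namespace Receiver

variable (R : Receiver σ β γ N M)

lemma mul_sum_eq_sum_resample [Fintype σ] (F : σ → ℝ≥0∞) :
    M * ∑ s, F s = ∑ s, ∑ m, F (R.resample s m) := by
  have h_inv : Function.Involutive fun p : σ × Fin M => (R.resample p.1 p.2, R.message p.1) := by
    rintro ⟨s, m⟩
    simp only [R.resample_resample, R.resample_message, R.message_resample]
  calc M * ∑ s, F s = ∑ p : σ × Fin M, F p.1 := by
        simp [Fintype.sum_prod_type, Finset.mul_sum]
    _ = ∑ p : σ × Fin M, F (R.resample p.1 p.2) :=
        (Equiv.sum_comp h_inv.toPerm fun p => F p.1).symm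
    _ = ∑ s, ∑ m, F (R.resample s m) := Fintype.sum_prod_type _

/-- The average error probability of a user when the memoryless channel `W` has the input block
`x s` at messages `s`. -/
noncomputable def errorProb [Fintype σ] (W : Kernel τ β) (x : σ → Fin N → τ) : ℝ≥0∞ :=
  (∑ s, Measure.pi (fun t => W (x s t)) {y | R.decode (fun t => R.output (y t)) ≠ R.message s})
    / Fintype.card σ

end Receiver

/-- A test between the memoryless channel `W`, observed through `u`, and the memoryless channel
`Q`: with input block `x s` it accepts `W` if the outputs lie in `A s`. On average over `s`, it
rejects `W` with probability at most `ε`, and accepts `Q` with probability `1 / M`. -/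
structure IsTest [Fintype σ] (W : Kernel τ β) (x : σ → Fin N → τ) (u : β → α) (Q : Kernel τ α)
    (M : ℕ) (ε : ℝ≥0∞) (A : σ → Set (Fin N → α)) : Prop where
  measurableSet : ∀ s, MeasurableSet (A s)
  error_le : (∑ s, Measure.pi (fun t => W (x s t)) {y | (fun t => u (y t)) ∉ A s})
    / Fintype.card σ ≤ ε
  mul_sum : M * ∑ s, Measure.pi (fun t => Q (x s t)) (A s) = Fintype.card σ

variable [Fintype σ] {W : Kernel τ β} {x : σ → Fin N → τ} {ε ε' : ℝ≥0∞}

lemma Receiver.isTest (R : Receiver σ β α N M) (hε : R.errorProb W x ≤ ε) {Q : Kernel τ α}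
    [IsMarkovKernel Q] (hQ : ∀ s m t, Q (x (R.resample s m) t) = Q (x s t)) :
    IsTest W x R.output Q M ε fun s => R.decode ⁻¹' {R.message s} where
  measurableSet s := R.measurable_decode (measurableSet_singleton _)
  error_le := hε
  mul_sum := by
    rw [R.mul_sum_eq_sum_resample]
    have h_total (s : σ) :
        ∑ m, Measure.pi (fun t => Q (x s t)) (R.decode ⁻¹' {m}) = 1 := by
      simpa using sum_measure_fiber_inter (Measure.pi fun t => Q (x s t)) Set.univ
        R.measurable_decode
    simp_rw [hQ, R.message_resample, h_total]
    simp

lemma IsTest.compProd {u : β → α} {Q₀ : Kernel τ α} [IsMarkovKernel Q₀]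
    {A : σ → Set (Fin N → α)} (hT : IsTest W x u Q₀ M ε A) (R : Receiver σ β γ N M')
    (hε' : R.errorProb W x ≤ ε') {Q₁ : Kernel (τ × α) γ} [IsMarkovKernel Q₁]
    (hA : ∀ s m, A (R.resample s m) = A s)
    (hQ₀ : ∀ s m t, Q₀ (x (R.resample s m) t) = Q₀ (x s t))
    (hQ₁ : ∀ s m t a, Q₁ (x (R.resample s m) t, a) = Q₁ (x s t, a)) :
    IsTest W x (fun y => (u y, R.output y)) (Q₀ ⊗ₖ Q₁) (M * M') (ε + ε') fun s =>
      (fun z t => (z t).2) ⁻¹' (R.decode ⁻¹' {R.message s}) ∩ (fun z t => (z t).1) ⁻¹' A s where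
  measurableSet s := by
    have h₁ : Measurable fun (z : Fin N → α × γ) t => (z t).1 := by fun_prop
    have h₂ : Measurable fun (z : Fin N → α × γ) t => (z t).2 := by fun_prop
    exact (h₂ (R.measurable_decode (measurableSet_singleton _))).inter (h₁ (hT.measurableSet s))
  error_le := by
    refine le_trans ?_ (add_le_add hT.error_le hε')
    rw [Receiver.errorProb, ← ENNReal.add_div, ← Finset.sum_add_distrib]
    gcongr with s
    refine (measure_mono fun y hy => ?_).trans (measure_union_le _ _)
    exact (not_and_or.1 hy).symm
  mul_sum := by
    have hQ (s : σ) (m : Fin M') (t : Fin N) :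
        (Q₀ ⊗ₖ Q₁) (x (R.resample s m) t) = (Q₀ ⊗ₖ Q₁) (x s t) :=
      compProd_apply_congr (hQ₀ s m t) (hQ₁ s m t)
    have h_fst (s : σ) :
        Measure.pi (fun t => (Q₀ ⊗ₖ Q₁) (x s t)) ((fun (z : Fin N → α × γ) t => (z t).1) ⁻¹' A s)
        = Measure.pi (fun t => Q₀ (x s t)) (A s) := by
      rw [← Measure.map_apply (by fun_prop) (hT.measurableSet s),
        pi_map_comp _ measurable_fst]
      simp_rw [compProd_map_fst_apply]
    have h_total (s : σ) : ∑ m, Measure.pi (fun t => (Q₀ ⊗ₖ Q₁) (x s t))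
          ((fun (z : Fin N → α × γ) t => (z t).2) ⁻¹' (R.decode ⁻¹' {m})
            ∩ (fun z t => (z t).1) ⁻¹' A s)
        = Measure.pi (fun t => Q₀ (x s t)) (A s) := by
      rw [← h_fst]
      exact sum_measure_fiber_inter _ _ (d := fun z : Fin N → α × γ => R.decode fun t => (z t).2)
        (R.measurable_decode.comp (by fun_prop))
    rw [Nat.cast_mul, mul_assoc, R.mul_sum_eq_sum_resample]
    simp_rw [hQ, R.message_resample, hA, h_total]
    exact hT.mul_sum

lemma IsTest.ofReal_log_le_sum_klDiv [IsMarkovKernel W] {u : β → α} (hu : Measurable u)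
    {Q : Kernel τ α} [IsMarkovKernel Q] {A : σ → Set (Fin N → α)} (hT : IsTest W x u Q M ε A)
    (hM : M ≠ 0) (s : σ) :
    ENNReal.ofReal (Real.log M)
      ≤ ∑ t, klDiv (W.map u (x s t)) (Q (x s t)) + M * Measure.pi (fun t => Q (x s t)) (A s)
        + ENNReal.ofReal (Real.log M)
          * Measure.pi (fun t => W (x s t)) {y | (fun t => u (y t)) ∉ A s} := by
  have := Kernel.IsMarkovKernel.map W hu
  have h_exp : ENNReal.ofReal (Real.exp (Real.log M)) = M := by
    rw [Real.exp_log (by positivity), ENNReal.ofReal_natCast]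
  have h_compl : Measure.pi (fun t => W (x s t)) {y | (fun t => u (y t)) ∉ A s}
      = Measure.pi (fun t => W.map u (x s t)) (A s)ᶜ := by
    simp_rw [Kernel.map_apply W hu]
    rw [← pi_map_comp _ hu, Measure.map_apply (by fun_prop) (hT.measurableSet s).compl]
    rfl
  have h := ofReal_mul_measure_le_klDiv_add (Measure.pi fun t => W.map u (x s t))
    (Measure.pi fun t => Q (x s t)) (hT.measurableSet s) (Real.log M)
  rw [klDiv_pi, h_exp] at h
  calc ENNReal.ofReal (Real.log M)
      = ENNReal.ofReal (Real.log M) * Measure.pi (fun t => W.map u (x s t)) (A s)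
        + ENNReal.ofReal (Real.log M) * Measure.pi (fun t => W.map u (x s t)) (A s)ᶜ := by
        rw [← mul_add, prob_add_prob_compl (hT.measurableSet s), mul_one]
    _ ≤ _ := by
        rw [h_compl]
        gcongr

/-- The divergence per letter, in nats, forced by a test of size `M` with block length `N` and error
`ε`, up to an additive loss `k` per block. -/
noncomputable def testBound (N M : ℕ) (k ε : ℝ≥0∞) : ℝ≥0∞ :=
  (ENNReal.ofReal (Real.log M) - (k + ENNReal.ofReal (Real.log M) * ε)) / N

lemma testBound_mul_le (hM : M ≠ 0) (hM' : M' ≠ 0) (k k' : ℝ≥0∞) {δ : ℝ≥0∞} (hε : ε ≤ δ)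
    (hε' : ε' ≤ δ) :
    testBound N (M * M') (k + k') δ ≤ testBound N M k ε + testBound N M' k' ε' := by
  have h_log : ENNReal.ofReal (Real.log (M * M' : ℕ))
      = ENNReal.ofReal (Real.log M) + ENNReal.ofReal (Real.log M') := by
    rw [Nat.cast_mul, Real.log_mul (by positivity) (by positivity),
      ENNReal.ofReal_add (Real.log_natCast_nonneg _) (Real.log_natCast_nonneg _)]
  calc testBound N (M * M') (k + k') δ ≤ testBound N M k δ + testBound N M' k' δ := by
        rw [testBound, testBound, testBound, ← ENNReal.add_div, h_log, add_mul, add_add_add_comm]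
        gcongr
        exact add_tsub_add_le_tsub_add_tsub
    _ ≤ testBound N M k ε + testBound N M' k' ε' := by
        unfold testBound
        gcongr

lemma testBound_anti {k k' δ : ℝ≥0∞} (hk : k ≤ k') (hε : ε ≤ δ) :
    testBound N M k' δ ≤ testBound N M k ε := by
  unfold testBound
  gcongr

lemma IsTest.testBound_le_lintegral_klDiv [MeasurableSingletonClass τ] [Nonempty σ]
    [NeZero N] [IsMarkovKernel W] {u : β → α} (hu : Measurable u) {Q : Kernel τ α}
    [IsMarkovKernel Q] {A : σ → Set (Fin N → α)} (hT : IsTest W x u Q M ε A) :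
    testBound N M 1 ε ≤ ∫⁻ y, klDiv (W.map u y) (Q y) ∂empirical x := by
  set n : ℝ≥0∞ := (Fintype.card σ : ℝ≥0∞) with hn
  set L := ENNReal.ofReal (Real.log M)
  have hn₀ : n ≠ 0 := by simp [hn]
  have hn_top : n ≠ ∞ := by simp [hn]
  have hM : M ≠ 0 := by
    rintro rfl
    exact hn₀ (by simpa using hT.mul_sum.symm)
  refine ENNReal.div_le_of_le_mul' (tsub_le_iff_right.2 ?_)
  refine (ENNReal.mul_le_mul_iff_right hn₀ hn_top).1 ?_
  calc n * L = ∑ _s : σ, L := by simp [hn]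
    _ ≤ _ := Finset.sum_le_sum fun s _ => hT.ofReal_log_le_sum_klDiv hu hM s
    _ = n * (N * ∫⁻ y, klDiv (W.map u y) (Q y) ∂empirical x) + n
        + L * ∑ s, Measure.pi (fun t => W (x s t)) {y | (fun t => u (y t)) ∉ A s} := by
      rw [Finset.sum_add_distrib, Finset.sum_add_distrib, sum_sum_eq_lintegral_empirical x
        fun y => klDiv (W.map u y) (Q y), ← Finset.mul_sum, hT.mul_sum, ← Finset.mul_sum]
    _ ≤ n * (N * ∫⁻ y, klDiv (W.map u y) (Q y) ∂empirical x) + n + L * (ε * n) := by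
      gcongr
      exact (ENNReal.div_le_iff hn₀ hn_top).1 hT.error_le
    _ = _ := by ring

lemma testBound_le_infKlDiv [MeasurableSingletonClass τ] [Nonempty σ]
    [NeZero N] [MeasurableSpace.CountableOrCountablyGenerated τ α] [IsMarkovKernel W] {u : β → α}
    (hu : Measurable u) {S : Set (Kernel τ α)} (hS : ∀ Q ∈ S, IsMarkovKernel Q)
    {A : σ → Set (Fin N → α)} (hT : ∀ Q ∈ S, IsTest W x u Q M ε A) :
    testBound N M 1 ε ≤ infKlDiv Prod.fst (fun p => u p.2) S (empirical x ⊗ₘ W) := by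
  have := isProbabilityMeasure_empirical x
  rw [infKlDiv_compProd _ _ hu hS]
  refine le_iInf₂ fun Q hQ => ?_
  have := hS Q hQ
  exact (hT Q hQ).testBound_le_lintegral_klDiv hu

end Testing

section Converse

variable {X₁ X₂ X₃ Y₁ Y₂ Y₃ : Type*} [MeasurableSpace X₁] [MeasurableSpace X₂]
  [MeasurableSpace X₃] [MeasurableSpace Y₁] [MeasurableSpace Y₂] [MeasurableSpace Y₃]

/-- Output laws of user 1 that depend only on the input of user 2. -/
def alternatives₁ : Set (Kernel (X₁ × X₂ × X₃) Y₁) := kernelsThrough (fun x => x.2.1) Y₁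

/-- Output laws of user 2 that depend only on the input of user 1. -/
def alternatives₂ : Set (Kernel (X₁ × X₂ × X₃) Y₂) := kernelsThrough (fun x => x.1) Y₂

/-- Output laws of users 1 and 3, drawn in this order, that do not use the input of user 3 and in
which the first output depends only on the input of user 2. -/
def alternatives₁₃ : Set (Kernel (X₁ × X₂ × X₃) (Y₁ × Y₃)) :=
  sequentialKernels alternatives₁ (fun p => (p.1.1, p.1.2.1, p.2)) Y₃

/-- Output laws of users 2 and 3, drawn in this order, that do not use the input of user 3 and in
which the first output depends only on the input of user 1. -/
def alternatives₂₃ : Set (Kernel (X₁ × X₂ × X₃) (Y₂ × Y₃)) :=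
  sequentialKernels alternatives₂ (fun p => (p.1.1, p.1.2.1, p.2)) Y₃

/-- Output laws drawn in the order 1, 2, 3, each depending only on the previous outputs and on the
inputs of their users. -/
def alternatives₁₂₃ : Set (Kernel (X₁ × X₂ × X₃) ((Y₁ × Y₂) × Y₃)) :=
  sequentialKernels
    (sequentialKernels (kernelsThrough (fun _ => ()) Y₁) (fun p => (p.1.1, p.2)) Y₂)
    (fun p => (p.1.2.1, p.2.2, p.1.1, p.2.1)) Y₃

/-- Output laws drawn in the order 2, 1, 3, each depending only on the previous outputs and on the
inputs of their users. -/
def alternatives₂₁₃ : Set (Kernel (X₁ × X₂ × X₃) ((Y₂ × Y₁) × Y₃)) :=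
  sequentialKernels
    (sequentialKernels (kernelsThrough (fun _ => ()) Y₂) (fun p => (p.1.2.1, p.2)) Y₁)
    (fun p => (p.1.2.1, p.2.1, p.1.1, p.2.2)) Y₃

lemma isDominable_alternatives₁ :
    IsDominable (alternatives₁ : Set (Kernel (X₁ × X₂ × X₃) Y₁)) :=
  isDominable_kernelsThrough (by fun_prop)

lemma isDominable_alternatives₂ :
    IsDominable (alternatives₂ : Set (Kernel (X₁ × X₂ × X₃) Y₂)) :=
  isDominable_kernelsThrough (by fun_prop)

lemma isDominable_alternatives₁₃ [StandardBorelSpace Y₃] [Nonempty Y₃] :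
    IsDominable (alternatives₁₃ : Set (Kernel (X₁ × X₂ × X₃) (Y₁ × Y₃))) :=
  isDominable_alternatives₁.sequentialKernels (by fun_prop) (r := fun q => q.2.2) (by fun_prop)
    fun _ => rfl

lemma isDominable_alternatives₂₃ [StandardBorelSpace Y₃] [Nonempty Y₃] :
    IsDominable (alternatives₂₃ : Set (Kernel (X₁ × X₂ × X₃) (Y₂ × Y₃))) :=
  isDominable_alternatives₂.sequentialKernels (by fun_prop) (r := fun q => q.2.2) (by fun_prop)
    fun _ => rfl

lemma isDominable_alternatives₁₂₃ [StandardBorelSpace Y₂] [Nonempty Y₂] [StandardBorelSpace Y₃]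
    [Nonempty Y₃] :
    IsDominable (alternatives₁₂₃ : Set (Kernel (X₁ × X₂ × X₃) ((Y₁ × Y₂) × Y₃))) :=
  IsDominable.sequentialKernels (r := fun q => (q.2.2.2, q.2.1))
    (IsDominable.sequentialKernels (r := fun q => q.2)
      (isDominable_kernelsThrough measurable_const) (by fun_prop) (by fun_prop) fun _ => rfl)
    (by fun_prop) (by fun_prop) fun _ => rfl

lemma isDominable_alternatives₂₁₃ [StandardBorelSpace Y₁] [Nonempty Y₁] [StandardBorelSpace Y₃]
    [Nonempty Y₃] :
    IsDominable (alternatives₂₁₃ : Set (Kernel (X₁ × X₂ × X₃) ((Y₂ × Y₁) × Y₃))) :=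
  IsDominable.sequentialKernels (r := fun q => (q.2.1, q.2.2.2))
    (IsDominable.sequentialKernels (r := fun q => q.2)
      (isDominable_kernelsThrough measurable_const) (by fun_prop) (by fun_prop) fun _ => rfl)
    (by fun_prop) (by fun_prop) fun _ => rfl

/-- The least divergence, in nats, of the channel from the alternatives under which the users'
messages cannot be decoded. The first minimum yields the bound `a(P)`, the second `b(P)`. -/
noncomputable def converseDivergence (W : Kernel (X₁ × X₂ × X₃) (Y₁ × Y₂ × Y₃))
    (P : ProbabilityMeasure (X₁ × X₂ × X₃)) : ℝ≥0∞ :=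
  min
    (min
      (infKlDiv Prod.fst (fun ω => (ω.2.1, ω.2.2.2)) alternatives₁₃ (jointLaw W P)
        + infKlDiv Prod.fst (fun ω => ω.2.2.1) alternatives₂ (jointLaw W P))
      (infKlDiv Prod.fst (fun ω => (ω.2.2.1, ω.2.2.2)) alternatives₂₃ (jointLaw W P)
        + infKlDiv Prod.fst (fun ω => ω.2.1) alternatives₁ (jointLaw W P)))
    (min
      (infKlDiv Prod.fst (fun ω => ((ω.2.1, ω.2.2.1), ω.2.2.2)) alternatives₁₂₃ (jointLaw W P))
      (infKlDiv Prod.fst (fun ω => ((ω.2.2.1, ω.2.1), ω.2.2.2)) alternatives₂₁₃ (jointLaw W P)))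

namespace Code

variable {N M₁ M₂ M₃ : ℕ} (c : Code X₁ X₂ X₃ Y₁ Y₂ Y₃ N M₁ M₂ M₃)
  {W : Kernel (X₁ × X₂ × X₃) (Y₁ × Y₂ × Y₃)}

/-- User 1 of the code `c`, as a receiver. -/
def receiver₁ : Receiver (Fin M₁ × Fin M₂ × Fin M₃) (Y₁ × Y₂ × Y₃) Y₁ N M₁ where
  message w := w.1
  resample w m := (m, w.2)
  output y := y.1
  decode := c.dec₁
  measurable_output := by fun_prop
  measurable_decode := c.measurable_dec₁
  message_resample _ _ := rfl
  resample_message _ := rfl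
  resample_resample _ _ _ := rfl

/-- User 2 of the code `c`, as a receiver. -/
def receiver₂ : Receiver (Fin M₁ × Fin M₂ × Fin M₃) (Y₁ × Y₂ × Y₃) Y₂ N M₂ where
  message w := w.2.1
  resample w m := (w.1, m, w.2.2)
  output y := y.2.1
  decode := c.dec₂
  measurable_output := by fun_prop
  measurable_decode := c.measurable_dec₂
  message_resample _ _ := rfl
  resample_message _ := rfl
  resample_resample _ _ _ := rfl

/-- User 3 of the code `c`, as a receiver. -/
def receiver₃ : Receiver (Fin M₁ × Fin M₂ × Fin M₃) (Y₁ × Y₂ × Y₃) Y₃ N M₃ where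
  message w := w.2.2
  resample w m := (w.1, w.2.1, m)
  output y := y.2.2
  decode := c.dec₃
  measurable_output := by fun_prop
  measurable_decode := c.measurable_dec₃
  message_resample _ _ := rfl
  resample_message _ := rfl
  resample_resample _ _ _ := rfl

lemma natCast_card_messages :
    (Fintype.card (Fin M₁ × Fin M₂ × Fin M₃) : ℝ≥0∞) = M₁ * M₂ * M₃ := by
  simp [mul_assoc]

lemma errorProb_receiver₁_le : c.receiver₁.errorProb W c.input ≤ c.errorProb W := by
  rw [Receiver.errorProb, natCast_card_messages]
  exact le_max_left _ _

lemma errorProb_receiver₂_le : c.receiver₂.errorProb W c.input ≤ c.errorProb W := by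
  rw [Receiver.errorProb, natCast_card_messages]
  exact (le_max_left _ _).trans (le_max_right _ _)

lemma errorProb_receiver₃_le : c.receiver₃.errorProb W c.input ≤ c.errorProb W := by
  rw [Receiver.errorProb, natCast_card_messages]
  exact (le_max_right _ _).trans (le_max_right _ _)

lemma isTest_alternatives₁ {Q : Kernel (X₁ × X₂ × X₃) Y₁} (hQ : Q ∈ alternatives₁) :
    IsTest W c.input (fun y => y.1) Q M₁ (c.errorProb W) fun w => c.dec₁ ⁻¹' {w.1} :=
  have := isDominable_alternatives₁.isMarkovKernel _ hQ
  c.receiver₁.isTest c.errorProb_receiver₁_le fun _ _ _ => apply_eq_of_mem_kernelsThrough hQ rfl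

lemma isTest_alternatives₂ {Q : Kernel (X₁ × X₂ × X₃) Y₂} (hQ : Q ∈ alternatives₂) :
    IsTest W c.input (fun y => y.2.1) Q M₂ (c.errorProb W) fun w => c.dec₂ ⁻¹' {w.2.1} :=
  have := isDominable_alternatives₂.isMarkovKernel _ hQ
  c.receiver₂.isTest c.errorProb_receiver₂_le fun _ _ _ => apply_eq_of_mem_kernelsThrough hQ rfl

lemma isTest_alternatives₁₃ {Q : Kernel (X₁ × X₂ × X₃) (Y₁ × Y₃)} (hQ : Q ∈ alternatives₁₃) :
    IsTest W c.input (fun y => (y.1, y.2.2)) Q (M₁ * M₃) (c.errorProb W + c.errorProb W) fun w =>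
      (fun z t => (z t).2) ⁻¹' (c.dec₃ ⁻¹' {w.2.2})
        ∩ (fun z t => (z t).1) ⁻¹' (c.dec₁ ⁻¹' {w.1}) := by
  obtain ⟨Q₀, hQ₀, Q₁, hQ₁, rfl⟩ := hQ
  have := isDominable_alternatives₁.isMarkovKernel _ hQ₀
  have := isMarkovKernel_of_mem_kernelsThrough hQ₁
  exact (c.isTest_alternatives₁ hQ₀).compProd c.receiver₃ c.errorProb_receiver₃_le
    (fun _ _ => rfl) (fun _ _ _ => apply_eq_of_mem_kernelsThrough hQ₀ rfl)
    fun _ _ _ _ => apply_eq_of_mem_kernelsThrough hQ₁ rfl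

lemma isTest_alternatives₂₃ {Q : Kernel (X₁ × X₂ × X₃) (Y₂ × Y₃)} (hQ : Q ∈ alternatives₂₃) :
    IsTest W c.input (fun y => (y.2.1, y.2.2)) Q (M₂ * M₃) (c.errorProb W + c.errorProb W)
      fun w => (fun z t => (z t).2) ⁻¹' (c.dec₃ ⁻¹' {w.2.2})
        ∩ (fun z t => (z t).1) ⁻¹' (c.dec₂ ⁻¹' {w.2.1}) := by
  obtain ⟨Q₀, hQ₀, Q₁, hQ₁, rfl⟩ := hQ
  have := isDominable_alternatives₂.isMarkovKernel _ hQ₀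
  have := isMarkovKernel_of_mem_kernelsThrough hQ₁
  exact (c.isTest_alternatives₂ hQ₀).compProd c.receiver₃ c.errorProb_receiver₃_le
    (fun _ _ => rfl) (fun _ _ _ => apply_eq_of_mem_kernelsThrough hQ₀ rfl)
    fun _ _ _ _ => apply_eq_of_mem_kernelsThrough hQ₁ rfl

lemma isTest_alternatives₁₂₃ {Q : Kernel (X₁ × X₂ × X₃) ((Y₁ × Y₂) × Y₃)}
    (hQ : Q ∈ alternatives₁₂₃) :
    IsTest W c.input (fun y => ((y.1, y.2.1), y.2.2)) Q (M₁ * M₂ * M₃)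
      (c.errorProb W + c.errorProb W + c.errorProb W) fun w =>
        (fun z t => (z t).2) ⁻¹' (c.dec₃ ⁻¹' {w.2.2})
          ∩ (fun z t => (z t).1) ⁻¹' ((fun z t => (z t).2) ⁻¹' (c.dec₂ ⁻¹' {w.2.1})
            ∩ (fun z t => (z t).1) ⁻¹' (c.dec₁ ⁻¹' {w.1})) := by
  obtain ⟨_, ⟨Q₀, hQ₀, Q₁, hQ₁, rfl⟩, Q₂, hQ₂, rfl⟩ := hQ
  have := isMarkovKernel_of_mem_kernelsThrough hQ₀
  have := isMarkovKernel_of_mem_kernelsThrough hQ₁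
  have := isMarkovKernel_of_mem_kernelsThrough hQ₂
  have h₀ {x x'} : Q₀ x = Q₀ x' := apply_eq_of_mem_kernelsThrough hQ₀ rfl
  exact ((c.receiver₁.isTest c.errorProb_receiver₁_le fun _ _ _ => h₀).compProd
      c.receiver₂ c.errorProb_receiver₂_le (fun _ _ => rfl) (fun _ _ _ => h₀)
      fun _ _ _ _ => apply_eq_of_mem_kernelsThrough hQ₁ rfl).compProd
    c.receiver₃ c.errorProb_receiver₃_le (fun _ _ => rfl)
    (fun _ _ _ => compProd_apply_congr h₀ fun _ => apply_eq_of_mem_kernelsThrough hQ₁ rfl)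
    fun _ _ _ _ => apply_eq_of_mem_kernelsThrough hQ₂ rfl

lemma isTest_alternatives₂₁₃ {Q : Kernel (X₁ × X₂ × X₃) ((Y₂ × Y₁) × Y₃)}
    (hQ : Q ∈ alternatives₂₁₃) :
    IsTest W c.input (fun y => ((y.2.1, y.1), y.2.2)) Q (M₂ * M₁ * M₃)
      (c.errorProb W + c.errorProb W + c.errorProb W) fun w =>
        (fun z t => (z t).2) ⁻¹' (c.dec₃ ⁻¹' {w.2.2})
          ∩ (fun z t => (z t).1) ⁻¹' ((fun z t => (z t).2) ⁻¹' (c.dec₁ ⁻¹' {w.1})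
            ∩ (fun z t => (z t).1) ⁻¹' (c.dec₂ ⁻¹' {w.2.1})) := by
  obtain ⟨_, ⟨Q₀, hQ₀, Q₁, hQ₁, rfl⟩, Q₂, hQ₂, rfl⟩ := hQ
  have := isMarkovKernel_of_mem_kernelsThrough hQ₀
  have := isMarkovKernel_of_mem_kernelsThrough hQ₁
  have := isMarkovKernel_of_mem_kernelsThrough hQ₂
  have h₀ {x x'} : Q₀ x = Q₀ x' := apply_eq_of_mem_kernelsThrough hQ₀ rfl
  exact ((c.receiver₂.isTest c.errorProb_receiver₂_le fun _ _ _ => h₀).compProd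
      c.receiver₁ c.errorProb_receiver₁_le (fun _ _ => rfl) (fun _ _ _ => h₀)
      fun _ _ _ _ => apply_eq_of_mem_kernelsThrough hQ₁ rfl).compProd
    c.receiver₃ c.errorProb_receiver₃_le (fun _ _ => rfl)
    (fun _ _ _ => compProd_apply_congr h₀ fun _ => apply_eq_of_mem_kernelsThrough hQ₁ rfl)
    fun _ _ _ _ => apply_eq_of_mem_kernelsThrough hQ₂ rfl

end Code

variable [StandardBorelSpace Y₁] [StandardBorelSpace Y₂] [StandardBorelSpace Y₃]
  [Nonempty Y₁] [Nonempty Y₂] [Nonempty Y₃]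

lemma Code.testBound_le_converseDivergence [MeasurableSingletonClass X₁]
    [MeasurableSingletonClass X₂] [MeasurableSingletonClass X₃] {N M₁ M₂ M₃ : ℕ} [NeZero N]
    [NeZero M₁] [NeZero M₂] [NeZero M₃] (c : Code X₁ X₂ X₃ Y₁ Y₂ Y₃ N M₁ M₂ M₃)
    (W : Kernel (X₁ × X₂ × X₃) (Y₁ × Y₂ × Y₃)) [IsMarkovKernel W] :
    testBound N (M₁ * M₂ * M₃) 2 (3 * c.errorProb W)
      ≤ converseDivergence W ⟨empirical c.input, isProbabilityMeasure_empirical c.input⟩ := by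
  have b₁ := testBound_le_infKlDiv (W := W) (u := fun y => y.1) (by fun_prop)
    isDominable_alternatives₁.isMarkovKernel fun _ => c.isTest_alternatives₁
  have b₂ := testBound_le_infKlDiv (W := W) (u := fun y => y.2.1) (by fun_prop)
    isDominable_alternatives₂.isMarkovKernel fun _ => c.isTest_alternatives₂
  have b₁₃ := testBound_le_infKlDiv (W := W) (u := fun y => (y.1, y.2.2)) (by fun_prop)
    isDominable_alternatives₁₃.isMarkovKernel fun _ => c.isTest_alternatives₁₃
  have b₂₃ := testBound_le_infKlDiv (W := W) (u := fun y => (y.2.1, y.2.2)) (by fun_prop)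
    isDominable_alternatives₂₃.isMarkovKernel fun _ => c.isTest_alternatives₂₃
  have b₁₂₃ := testBound_le_infKlDiv (W := W) (u := fun y => ((y.1, y.2.1), y.2.2))
    (by fun_prop) isDominable_alternatives₁₂₃.isMarkovKernel fun _ => c.isTest_alternatives₁₂₃
  have b₂₁₃ := testBound_le_infKlDiv (W := W) (u := fun y => ((y.2.1, y.1), y.2.2))
    (by fun_prop) isDominable_alternatives₂₁₃.isMarkovKernel fun _ => c.isTest_alternatives₂₁₃
  set e := c.errorProb W
  have h₃ : e + e + e = 3 * e := by ring
  have h₂ : e + e ≤ 3 * e := le_self_add.trans_eq h₃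
  have h₁ : e ≤ 3 * e := le_self_add.trans h₂
  have s₁₃ := testBound_mul_le (N := N) (NeZero.ne (M₁ * M₃)) (NeZero.ne M₂) 1 1 h₂ h₁
  have s₂₃ := testBound_mul_le (N := N) (NeZero.ne (M₂ * M₃)) (NeZero.ne M₁) 1 1 h₂ h₁
  rw [one_add_one_eq_two] at s₁₃ s₂₃
  rw [mul_right_comm] at s₁₃
  rw [mul_comm, ← mul_assoc] at s₂₃
  exact le_min
    (le_min (s₁₃.trans (add_le_add b₁₃ b₂)) (s₂₃.trans (add_le_add b₂₃ b₁)))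
    (le_min ((testBound_anti one_le_two h₃.le).trans b₁₂₃)
      ((testBound_anti one_le_two h₃.le).trans (mul_comm M₁ M₂ ▸ b₂₁₃)))

end Converse

section Asymptotics

lemma one_le_two_rpow_mul (N : ℕ) {R : ℝ} (hR : 0 ≤ R) : (1 : ℝ) ≤ (2 : ℝ) ^ ((N : ℝ) * R) :=
  Real.one_le_rpow one_le_two (by positivity)

lemma numMessages_pos (N : ℕ) {R : ℝ} (hR : 0 ≤ R) : 0 < numMessages N R :=
  Nat.floor_pos.2 (one_le_two_rpow_mul N hR)

lemma log_numMessages_le (N : ℕ) {R : ℝ} (hR : 0 ≤ R) :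
    Real.log (numMessages N R) ≤ N * R * Real.log 2 := by
  rw [← Real.log_rpow two_pos]
  exact Real.log_le_log (by exact_mod_cast numMessages_pos N hR) (Nat.floor_le (by positivity))

lemma sub_log_two_le_log_numMessages (N : ℕ) {R : ℝ} (hR : 0 ≤ R) :
    N * R * Real.log 2 - Real.log 2 ≤ Real.log (numMessages N R) := by
  have h_one : (1 : ℝ) ≤ numMessages N R := by exact_mod_cast numMessages_pos N hR
  have h_floor : (2 : ℝ) ^ ((N : ℝ) * R) < numMessages N R + 1 := Nat.lt_floor_add_one _
  rw [← Real.log_rpow two_pos, ← Real.log_div (by positivity) two_ne_zero]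
  exact Real.log_le_log (by positivity) (by linarith)

lemma tendsto_log_numMessages_div {R : ℝ} (hR : 0 ≤ R) :
    Tendsto (fun N : ℕ => Real.log (numMessages N R) / N) atTop (𝓝 (R * Real.log 2)) := by
  have h_lower : Tendsto (fun N : ℕ => R * Real.log 2 - Real.log 2 / N) atTop
      (𝓝 (R * Real.log 2)) := by
    simpa using tendsto_const_nhds.sub (tendsto_const_div_atTop_nhds_zero_nat (Real.log 2))
  refine tendsto_of_tendsto_of_tendsto_of_le_of_le' h_lower tendsto_const_nhds ?_ ?_
  all_goals filter_upwards [eventually_gt_atTop 0] with N hN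
  · rw [le_div_iff₀ (by positivity)]
    refine le_of_eq_of_le ?_ (sub_log_two_le_log_numMessages N hR)
    field_simp
  · rw [div_le_iff₀ (by positivity)]
    exact (log_numMessages_le N hR).trans_eq (by ring)

lemma tendsto_testBound {M : ℕ → ℕ} {L : ℝ}
    (hM : Tendsto (fun N : ℕ => Real.log (M N) / N) atTop (𝓝 L)) {k : ℝ≥0∞} (hk : k ≠ ∞)
    {ε : ℕ → ℝ≥0∞} (hε : Tendsto ε atTop (𝓝 0)) :
    Tendsto (fun N => testBound N (M N) k (ε N)) atTop (𝓝 (ENNReal.ofReal L)) := by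
  have h_eq (N : ℕ) (hN : 0 < N) : testBound N (M N) k (ε N)
      = ENNReal.ofReal (Real.log (M N) / N)
        - (k / N + ENNReal.ofReal (Real.log (M N) / N) * ε N) := by
    rw [testBound, ENNReal.sub_div fun _ _ => by positivity, ENNReal.add_div,
      ENNReal.ofReal_div_of_pos (by positivity), ENNReal.ofReal_natCast, ENNReal.mul_div_right_comm]
  have h_ofReal := ENNReal.tendsto_ofReal hM
  have h_k : Tendsto (fun N : ℕ => k / N) atTop (𝓝 0) := by
    simpa using ENNReal.Tendsto.const_div ENNReal.tendsto_nat_nhds_top (.inr hk)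
  have h_mul := ENNReal.Tendsto.mul h_ofReal (.inr ENNReal.zero_ne_top) hε
    (.inr ENNReal.ofReal_ne_top)
  have h_lim := ENNReal.Tendsto.sub h_ofReal (h_k.add h_mul) (.inl ENNReal.ofReal_ne_top)
  rw [mul_zero, add_zero, tsub_zero] at h_lim
  exact h_lim.congr' ((eventually_gt_atTop 0).mono fun N hN => (h_eq N hN).symm)

end Asymptotics

section SumCapacity

variable {X₁ X₂ X₃ Y₁ Y₂ Y₃ : Type*} [MeasurableSpace X₁] [MeasurableSpace X₂]
  [MeasurableSpace X₃] [MeasurableSpace Y₁] [MeasurableSpace Y₂] [MeasurableSpace Y₃]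
  (W : Kernel (X₁ × X₂ × X₃) (Y₁ × Y₂ × Y₃)) [IsMarkovKernel W]

lemma sumCapacity_mul_log_two_le_iSup_converseDivergence [MeasurableSingletonClass X₁]
    [MeasurableSingletonClass X₂] [MeasurableSingletonClass X₃] [StandardBorelSpace Y₁]
    [StandardBorelSpace Y₂] [StandardBorelSpace Y₃] [Nonempty Y₁] [Nonempty Y₂] [Nonempty Y₃] :
    sumCapacity W * ENNReal.ofReal (Real.log 2) ≤ ⨆ P, converseDivergence W P := by
  simp only [sumCapacity, ENNReal.iSup_mul]
  refine iSup₂_le fun R ⟨h₁, h₂, h₃, c, hc⟩ => ?_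
  rw [← ENNReal.ofReal_mul (by positivity)]
  have hM (N : ℕ) {r : ℝ} (hr : 0 ≤ r) : NeZero (numMessages N r) := .of_pos (numMessages_pos N hr)
  have h_log : Tendsto (fun N : ℕ =>
      Real.log (numMessages N R.1 * numMessages N R.2.1 * numMessages N R.2.2 : ℕ) / N) atTop
      (𝓝 ((R.1 + R.2.1 + R.2.2) * Real.log 2)) := by
    rw [add_mul, add_mul]
    refine (((tendsto_log_numMessages_div h₁).add (tendsto_log_numMessages_div h₂)).add
      (tendsto_log_numMessages_div h₃)).congr fun N => ?_
    have := hM N h₁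
    have := hM N h₂
    have := hM N h₃
    rw [Nat.cast_mul, Nat.cast_mul, Real.log_mul (by simp [NeZero.ne]) (by simp [NeZero.ne]),
      Real.log_mul (by simp [NeZero.ne]) (by simp [NeZero.ne]), add_div, add_div]
  have h_error : Tendsto (fun N => 3 * (c N).errorProb W) atTop (𝓝 0) := by
    simpa using ENNReal.Tendsto.const_mul hc (.inr (ENNReal.ofNat_ne_top (n := 3)))
  refine le_of_tendsto (tendsto_testBound h_log (k := 2) (by finiteness) h_error) ?_
  filter_upwards [eventually_ne_atTop 0] with N hN
  have : NeZero N := ⟨hN⟩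
  have := hM N h₁
  have := hM N h₂
  have := hM N h₃
  exact ((c N).testBound_le_converseDivergence W).trans (le_iSup (converseDivergence W) _)

variable (P : ProbabilityMeasure (X₁ × X₂ × X₃))

lemma infKlDiv_alternatives₁_le [StandardBorelSpace X₁] [StandardBorelSpace X₃]
    [StandardBorelSpace Y₁] [Nonempty X₁] [Nonempty X₃] [Nonempty Y₁] :
    infKlDiv Prod.fst (fun ω => ω.2.1) alternatives₁ (jointLaw W P)
      ≤ condMutualInfo (fun ω => ω.2.1) (fun ω => (ω.1.1, ω.1.2.2)) (fun ω => ω.1.2.1)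
          (jointLaw W P) * ENNReal.ofReal (Real.log 2) :=
  (infKlDiv_kernelsThrough_le_condMutualInfo (jointLaw W P)
    (T := fun ω => ω.1) (U := fun ω => ω.2.1) (by fun_prop) (by fun_prop)
    (f := fun p => p.2.1) (by fun_prop) (h := fun p => (p.1, p.2.2)) (by fun_prop)
    (r := fun p => (p.2.1, p.1, p.2.2)) (by fun_prop) (fun _ => rfl) fun _ => rfl :)

lemma infKlDiv_alternatives₂_le [StandardBorelSpace X₂] [StandardBorelSpace X₃]
    [StandardBorelSpace Y₂] [Nonempty X₂] [Nonempty X₃] [Nonempty Y₂] :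
    infKlDiv Prod.fst (fun ω => ω.2.2.1) alternatives₂ (jointLaw W P)
      ≤ condMutualInfo (fun ω => ω.2.2.1) (fun ω => (ω.1.2.1, ω.1.2.2)) (fun ω => ω.1.1)
          (jointLaw W P) * ENNReal.ofReal (Real.log 2) :=
  (infKlDiv_kernelsThrough_le_condMutualInfo (jointLaw W P)
    (T := fun ω => ω.1) (U := fun ω => ω.2.2.1) (by fun_prop) (by fun_prop)
    (f := fun p => p.1) (by fun_prop) (h := fun p => (p.2.1, p.2.2)) (by fun_prop)
    (r := fun p => (p.1, p.2.1, p.2.2)) (by fun_prop) (fun _ => rfl) fun _ => rfl :)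

lemma infKlDiv_alternatives₁₃_le [StandardBorelSpace X₁] [StandardBorelSpace X₃]
    [StandardBorelSpace Y₁] [StandardBorelSpace Y₃] [Nonempty X₁] [Nonempty X₃] [Nonempty Y₁]
    [Nonempty Y₃] :
    infKlDiv Prod.fst (fun ω => (ω.2.1, ω.2.2.2)) alternatives₁₃ (jointLaw W P)
      ≤ (condMutualInfo (fun ω => ω.2.1) (fun ω => (ω.1.1, ω.1.2.2)) (fun ω => ω.1.2.1)
          (jointLaw W P)
        + condMutualInfo (fun ω => ω.2.2.2) (fun ω => ω.1.2.2)
          (fun ω => (ω.1.1, ω.1.2.1, ω.2.1)) (jointLaw W P)) * ENNReal.ofReal (Real.log 2) := by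
  have h_seq := infKlDiv_sequentialKernels_le (jointLaw W P) (T := Prod.fst)
    (U₀ := fun ω => ω.2.1) (U₁ := fun ω => ω.2.2.2) (by fun_prop) (by fun_prop) (by fun_prop)
    isDominable_alternatives₁.isMarkovKernel fun p => (p.1.1, p.1.2.1, p.2)
  have h₃ := infKlDiv_kernelsThrough_le_condMutualInfo (jointLaw W P)
    (T := fun ω => (ω.1, ω.2.1)) (U := fun ω => ω.2.2.2) (by fun_prop) (by fun_prop)
    (f := fun p => (p.1.1, p.1.2.1, p.2)) (by fun_prop) (h := fun p => p.1.2.2) (by fun_prop)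
    (r := fun p => ((p.1.1, p.1.2.1, p.2), p.1.2.2)) (by fun_prop) (fun _ => rfl) fun _ => rfl
  rw [add_mul]
  exact h_seq.trans (add_le_add (infKlDiv_alternatives₁_le W P) h₃)

lemma infKlDiv_alternatives₂₃_le [StandardBorelSpace X₂] [StandardBorelSpace X₃]
    [StandardBorelSpace Y₂] [StandardBorelSpace Y₃] [Nonempty X₂] [Nonempty X₃] [Nonempty Y₂]
    [Nonempty Y₃] :
    infKlDiv Prod.fst (fun ω => (ω.2.2.1, ω.2.2.2)) alternatives₂₃ (jointLaw W P)
      ≤ (condMutualInfo (fun ω => ω.2.2.1) (fun ω => (ω.1.2.1, ω.1.2.2)) (fun ω => ω.1.1)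
          (jointLaw W P)
        + condMutualInfo (fun ω => ω.2.2.2) (fun ω => ω.1.2.2)
          (fun ω => (ω.1.1, ω.1.2.1, ω.2.2.1)) (jointLaw W P)) * ENNReal.ofReal (Real.log 2) := by
  have h_seq := infKlDiv_sequentialKernels_le (jointLaw W P) (T := Prod.fst)
    (U₀ := fun ω => ω.2.2.1) (U₁ := fun ω => ω.2.2.2) (by fun_prop) (by fun_prop) (by fun_prop)
    isDominable_alternatives₂.isMarkovKernel fun p => (p.1.1, p.1.2.1, p.2)
  have h₃ := infKlDiv_kernelsThrough_le_condMutualInfo (jointLaw W P)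
    (T := fun ω => (ω.1, ω.2.2.1)) (U := fun ω => ω.2.2.2) (by fun_prop) (by fun_prop)
    (f := fun p => (p.1.1, p.1.2.1, p.2)) (by fun_prop) (h := fun p => p.1.2.2) (by fun_prop)
    (r := fun p => ((p.1.1, p.1.2.1, p.2), p.1.2.2)) (by fun_prop) (fun _ => rfl) fun _ => rfl
  rw [add_mul]
  exact h_seq.trans (add_le_add (infKlDiv_alternatives₂_le W P) h₃)

lemma infKlDiv_alternatives₁₂₃_le [StandardBorelSpace X₂] [StandardBorelSpace X₃]
    [StandardBorelSpace Y₂] [StandardBorelSpace Y₃] [Nonempty X₂] [Nonempty X₃] [Nonempty Y₂]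
    [Nonempty Y₃] :
    infKlDiv Prod.fst (fun ω => ((ω.2.1, ω.2.2.1), ω.2.2.2)) alternatives₁₂₃ (jointLaw W P)
      ≤ (mutualInfo (fun ω => ω.2.1) (fun ω => (ω.1.1, ω.1.2.1, ω.1.2.2)) (jointLaw W P)
        + condMutualInfo (fun ω => ω.2.2.1) (fun ω => (ω.1.2.1, ω.1.2.2))
          (fun ω => (ω.1.1, ω.2.1)) (jointLaw W P)
        + condMutualInfo (fun ω => ω.2.2.2) (fun ω => ω.1.2.2)
          (fun ω => (ω.1.2.1, ω.2.2.1, ω.1.1, ω.2.1)) (jointLaw W P))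
        * ENNReal.ofReal (Real.log 2) := by
  have hS := isDominable_kernelsThrough (α := Y₁)
    (measurable_const (a := ()) : Measurable fun _ : X₁ × X₂ × X₃ => ())
  have hS' := hS.sequentialKernels (β := Y₂) (g := fun p => (p.1.1, p.2)) (by fun_prop)
    (r := Prod.snd) (by fun_prop) fun _ => rfl
  have h₁ := infKlDiv_kernelsThrough_const_le_mutualInfo (jointLaw W P) (T := Prod.fst)
    (U := fun ω => ω.2.1) (by fun_prop) (by fun_prop)
  have h₂ := infKlDiv_kernelsThrough_le_condMutualInfo (jointLaw W P)
    (T := fun ω => (ω.1, ω.2.1)) (U := fun ω => ω.2.2.1) (by fun_prop) (by fun_prop)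
    (f := fun p => (p.1.1, p.2)) (by fun_prop) (h := fun p => (p.1.2.1, p.1.2.2)) (by fun_prop)
    (r := fun p => ((p.1.1, p.2.1, p.2.2), p.1.2)) (by fun_prop) (fun _ => rfl) fun _ => rfl
  have h₃ := infKlDiv_kernelsThrough_le_condMutualInfo (jointLaw W P)
    (T := fun ω => (ω.1, (ω.2.1, ω.2.2.1))) (U := fun ω => ω.2.2.2) (by fun_prop) (by fun_prop)
    (f := fun p => (p.1.2.1, p.2.2, p.1.1, p.2.1)) (by fun_prop)
    (h := fun p => p.1.2.2) (by fun_prop)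
    (r := fun p => ((p.1.2.2.1, p.1.1, p.2), (p.1.2.2.2, p.1.2.1))) (by fun_prop) (fun _ => rfl)
    fun _ => rfl
  have h₁₂ := infKlDiv_sequentialKernels_le (jointLaw W P) (T := Prod.fst)
    (U₀ := fun ω => ω.2.1) (U₁ := fun ω => ω.2.2.1) (by fun_prop) (by fun_prop) (by fun_prop)
    hS.isMarkovKernel fun p => (p.1.1, p.2)
  have h₁₂₃ := infKlDiv_sequentialKernels_le (jointLaw W P) (T := Prod.fst)
    (U₀ := fun ω => (ω.2.1, ω.2.2.1)) (U₁ := fun ω => ω.2.2.2) (by fun_prop) (by fun_prop)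
    (by fun_prop) hS'.isMarkovKernel fun p => (p.1.2.1, p.2.2, p.1.1, p.2.1)
  rw [add_mul, add_mul]
  exact h₁₂₃.trans (add_le_add (h₁₂.trans (add_le_add h₁ h₂)) h₃)

lemma infKlDiv_alternatives₂₁₃_le [StandardBorelSpace X₁] [StandardBorelSpace X₃]
    [StandardBorelSpace Y₁] [StandardBorelSpace Y₃] [Nonempty X₁] [Nonempty X₃] [Nonempty Y₁]
    [Nonempty Y₃] :
    infKlDiv Prod.fst (fun ω => ((ω.2.2.1, ω.2.1), ω.2.2.2)) alternatives₂₁₃ (jointLaw W P)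
      ≤ (mutualInfo (fun ω => ω.2.2.1) (fun ω => (ω.1.1, ω.1.2.1, ω.1.2.2)) (jointLaw W P)
        + condMutualInfo (fun ω => ω.2.1) (fun ω => (ω.1.1, ω.1.2.2))
          (fun ω => (ω.1.2.1, ω.2.2.1)) (jointLaw W P)
        + condMutualInfo (fun ω => ω.2.2.2) (fun ω => ω.1.2.2)
          (fun ω => (ω.1.2.1, ω.2.2.1, ω.1.1, ω.2.1)) (jointLaw W P))
        * ENNReal.ofReal (Real.log 2) := by
  have hS := isDominable_kernelsThrough (α := Y₂)
    (measurable_const (a := ()) : Measurable fun _ : X₁ × X₂ × X₃ => ())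
  have hS' := hS.sequentialKernels (β := Y₁) (g := fun p => (p.1.2.1, p.2)) (by fun_prop)
    (r := Prod.snd) (by fun_prop) fun _ => rfl
  have h₂ := infKlDiv_kernelsThrough_const_le_mutualInfo (jointLaw W P) (T := Prod.fst)
    (U := fun ω => ω.2.2.1) (by fun_prop) (by fun_prop)
  have h₁ := infKlDiv_kernelsThrough_le_condMutualInfo (jointLaw W P)
    (T := fun ω => (ω.1, ω.2.2.1)) (U := fun ω => ω.2.1) (by fun_prop) (by fun_prop)
    (f := fun p => (p.1.2.1, p.2)) (by fun_prop) (h := fun p => (p.1.1, p.1.2.2)) (by fun_prop)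
    (r := fun p => ((p.2.1, p.1.1, p.2.2), p.1.2)) (by fun_prop) (fun _ => rfl) fun _ => rfl
  have h₃ := infKlDiv_kernelsThrough_le_condMutualInfo (jointLaw W P)
    (T := fun ω => (ω.1, (ω.2.2.1, ω.2.1))) (U := fun ω => ω.2.2.2) (by fun_prop) (by fun_prop)
    (f := fun p => (p.1.2.1, p.2.1, p.1.1, p.2.2)) (by fun_prop)
    (h := fun p => p.1.2.2) (by fun_prop)
    (r := fun p => ((p.1.2.2.1, p.1.1, p.2), (p.1.2.1, p.1.2.2.2))) (by fun_prop) (fun _ => rfl)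
    fun _ => rfl
  have h₂₁ := infKlDiv_sequentialKernels_le (jointLaw W P) (T := Prod.fst)
    (U₀ := fun ω => ω.2.2.1) (U₁ := fun ω => ω.2.1) (by fun_prop) (by fun_prop) (by fun_prop)
    hS.isMarkovKernel fun p => (p.1.2.1, p.2)
  have h₂₁₃ := infKlDiv_sequentialKernels_le (jointLaw W P) (T := Prod.fst)
    (U₀ := fun ω => (ω.2.2.1, ω.2.1)) (U₁ := fun ω => ω.2.2.2) (by fun_prop) (by fun_prop)
    (by fun_prop) hS'.isMarkovKernel fun p => (p.1.2.1, p.2.1, p.1.1, p.2.2)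
  rw [add_mul, add_mul]
  exact h₂₁₃.trans (add_le_add (h₂₁.trans (add_le_add h₂ h₁)) h₃)

variable [StandardBorelSpace X₁] [StandardBorelSpace X₂] [StandardBorelSpace X₃]
  [StandardBorelSpace Y₁] [StandardBorelSpace Y₂] [StandardBorelSpace Y₃]
  [Nonempty X₁] [Nonempty X₂] [Nonempty X₃] [Nonempty Y₁] [Nonempty Y₂] [Nonempty Y₃]

lemma converseDivergence_le_boundA_mul_log_two :
    converseDivergence W P ≤ boundA W P * ENNReal.ofReal (Real.log 2) := by
  refine (min_le_left _ _).trans ?_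
  rw [boundA, ← min_add_add_right, ← min_add_add_right, min_mul]
  refine min_le_min
    ((add_le_add (infKlDiv_alternatives₁₃_le W P) (infKlDiv_alternatives₂_le W P)).trans_eq ?_)
    ((add_le_add (infKlDiv_alternatives₂₃_le W P) (infKlDiv_alternatives₁_le W P)).trans_eq ?_)
  all_goals ring

lemma converseDivergence_le_boundB_mul_log_two :
    converseDivergence W P ≤ boundB W P * ENNReal.ofReal (Real.log 2) := by
  refine (min_le_right _ _).trans ?_
  rw [boundB, ← min_add_add_right, min_mul]
  refine min_le_min (infKlDiv_alternatives₁₂₃_le W P)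
    ((infKlDiv_alternatives₂₁₃_le W P).trans_eq ?_)
  ring

end SumCapacity

section Maximizer

lemma continuous_lintegral_probabilityMeasure {τ : Type*} [MeasurableSpace τ] [TopologicalSpace τ]
    [DiscreteTopology τ] [OpensMeasurableSpace τ] [Finite τ] {f : τ → ℝ≥0∞} (hf : ∀ x, f x ≠ ∞) :
    Continuous fun P : ProbabilityMeasure τ => ∫⁻ x, f x ∂(P : Measure τ) := by
  lift f to τ → ℝ≥0 using hf
  exact ProbabilityMeasure.continuous_lintegral_boundedContinuousFunction
    (.mkOfCompact ⟨f, continuous_of_discreteTopology⟩)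

lemma IsDominable.biInf_lintegral_klDiv {τ α : Type*} [MeasurableSpace τ] [MeasurableSpace α]
    [Finite τ] [Nonempty τ] {S : Set (Kernel τ α)} (hS : IsDominable S) (K : Kernel τ α)
    [IsMarkovKernel K] (P : Measure τ) [IsProbabilityMeasure P] :
    ⨅ Q ∈ S, ∫⁻ x, klDiv (K x) (Q x) ∂P
      = ⨅ Q ∈ {Q ∈ S | ∀ x, klDiv (K x) (Q x) ≠ ∞}, ∫⁻ x, klDiv (K x) (Q x) ∂P := by
  refine le_antisymm (biInf_mono fun _ hQ => hQ.1) (le_iInf₂ fun Q hQ => ?_)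
  refine ENNReal.le_of_forall_pos_le_add fun η hη _ => ?_
  obtain ⟨Q', hQ', h⟩ := hS.exists_klDiv_ne_top K hQ hη
  calc _ ≤ ∫⁻ x, klDiv (K x) (Q' x) ∂P := iInf₂_le Q' ⟨hQ', fun x => (h x).1⟩
    _ ≤ ∫⁻ x, (klDiv (K x) (Q x) + η) ∂P := lintegral_mono fun x => (h x).2
    _ = ∫⁻ x, klDiv (K x) (Q x) ∂P + η := by
      rw [lintegral_add_right _ measurable_const, lintegral_const, measure_univ, mul_one]

lemma IsDominable.upperSemicontinuous_infKlDiv {τ α β : Type*} [MeasurableSpace τ]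
    [TopologicalSpace τ] [DiscreteTopology τ] [OpensMeasurableSpace τ] [Finite τ] [Nonempty τ]
    [MeasurableSpace α] [MeasurableSpace β] {S : Set (Kernel τ α)} (hS : IsDominable S)
    (W : Kernel τ β) [IsMarkovKernel W] {u : β → α} (hu : Measurable u) :
    UpperSemicontinuous fun P : ProbabilityMeasure τ =>
      infKlDiv Prod.fst (fun p => u p.2) S ((P : Measure τ) ⊗ₘ W) := by
  have := Kernel.IsMarkovKernel.map W hu
  simp_rw [infKlDiv_compProd _ W hu hS.isMarkovKernel, hS.biInf_lintegral_klDiv (W.map u)]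
  exact upperSemicontinuous_biInf fun Q hQ =>
    (continuous_lintegral_probabilityMeasure hQ.2).upperSemicontinuous

lemma exists_forall_converseDivergence_le {X₁ X₂ X₃ Y₁ Y₂ Y₃ : Type*} [MeasurableSpace X₁]
    [MeasurableSpace X₂] [MeasurableSpace X₃] [MeasurableSingletonClass X₁]
    [MeasurableSingletonClass X₂] [MeasurableSingletonClass X₃] [Finite X₁] [Finite X₂]
    [Finite X₃] [Nonempty X₁] [Nonempty X₂] [Nonempty X₃] [MeasurableSpace Y₁]
    [MeasurableSpace Y₂] [MeasurableSpace Y₃] [StandardBorelSpace Y₁] [StandardBorelSpace Y₂]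
    [StandardBorelSpace Y₃] [Nonempty Y₁] [Nonempty Y₂] [Nonempty Y₃]
    (W : Kernel (X₁ × X₂ × X₃) (Y₁ × Y₂ × Y₃)) [IsMarkovKernel W] :
    ∃ P, ∀ P', converseDivergence W P' ≤ converseDivergence W P := by
  let : TopologicalSpace (X₁ × X₂ × X₃) := ⊥
  have : DiscreteTopology (X₁ × X₂ × X₃) := ⟨rfl⟩
  have h₁ := isDominable_alternatives₁.upperSemicontinuous_infKlDiv W (u := fun y => y.1)
    (by fun_prop)
  have h₂ := isDominable_alternatives₂.upperSemicontinuous_infKlDiv W (u := fun y => y.2.1)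
    (by fun_prop)
  have h₁₃ := isDominable_alternatives₁₃.upperSemicontinuous_infKlDiv W
    (u := fun y => (y.1, y.2.2)) (by fun_prop)
  have h₂₃ := isDominable_alternatives₂₃.upperSemicontinuous_infKlDiv W
    (u := fun y => (y.2.1, y.2.2)) (by fun_prop)
  have h₁₂₃ := isDominable_alternatives₁₂₃.upperSemicontinuous_infKlDiv W
    (u := fun y => ((y.1, y.2.1), y.2.2)) (by fun_prop)
  have h₂₁₃ := isDominable_alternatives₂₁₃.upperSemicontinuous_infKlDiv W
    (u := fun y => ((y.2.1, y.1), y.2.2)) (by fun_prop)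
  have h : UpperSemicontinuous (converseDivergence W) :=
    ((h₁₃.add h₂).inf (h₂₃.add h₁)).inf (h₁₂₃.inf h₂₁₃)
  inhabit X₁ × X₂ × X₃
  obtain ⟨P, -, hP⟩ := (h.upperSemicontinuousOn Set.univ).exists_isMaxOn Set.univ_nonempty
    isCompact_univ
  exact ⟨P, fun P' => hP (Set.mem_univ P')⟩

end Maximizer

end CoMS

theorem mainTheorem2 {X₁ X₂ X₃ Y₁ Y₂ Y₃ : Type*}
    [MeasurableSpace X₁] [MeasurableSpace X₂] [MeasurableSpace X₃]
    [MeasurableSpace Y₁] [MeasurableSpace Y₂] [MeasurableSpace Y₃]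
    [StandardBorelSpace X₁] [StandardBorelSpace X₂] [StandardBorelSpace X₃]
    [StandardBorelSpace Y₁] [StandardBorelSpace Y₂] [StandardBorelSpace Y₃]
    [Nonempty X₁] [Nonempty X₂] [Nonempty X₃] [Nonempty Y₁] [Nonempty Y₂] [Nonempty Y₃]
    (W : Kernel (X₁ × X₂ × X₃) (Y₁ × Y₂ × Y₃)) [IsMarkovKernel W] :
    (CoMS.sumCapacity W ≤
        ⨆ P : ProbabilityMeasure (X₁ × X₂ × X₃), min (CoMS.boundA W P) (CoMS.boundB W P)) ∧
      (Finite X₁ → Finite X₂ → Finite X₃ →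
        ∃ P : ProbabilityMeasure (X₁ × X₂ × X₃),
          CoMS.sumCapacity W ≤ min (CoMS.boundA W P) (CoMS.boundB W P)) := by
  have h_sup := CoMS.sumCapacity_mul_log_two_le_iSup_converseDivergence W
  have h_min (P : ProbabilityMeasure (X₁ × X₂ × X₃)) : CoMS.converseDivergence W P
      ≤ min (CoMS.boundA W P) (CoMS.boundB W P) * ENNReal.ofReal (Real.log 2) := by
    rw [min_mul]
    exact le_min (CoMS.converseDivergence_le_boundA_mul_log_two W P)
      (CoMS.converseDivergence_le_boundB_mul_log_two W P)
  have h_cancel {a b : ℝ≥0∞} :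
      a * ENNReal.ofReal (Real.log 2) ≤ b * ENNReal.ofReal (Real.log 2) → a ≤ b :=
    (ENNReal.mul_le_mul_iff_left CoMS.log_two_ne_zero ENNReal.ofReal_ne_top).1
  refine ⟨h_cancel ?_, fun _ _ _ => ?_⟩
  · rw [ENNReal.iSup_mul]
    exact h_sup.trans (iSup_mono h_min)
  · obtain ⟨P, hP⟩ := CoMS.exists_forall_converseDivergence_le W
    exact ⟨P, h_cancel (h_sup.trans ((iSup_le hP).trans (h_min P)))⟩
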